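/- **Conventions.** For a finite set $I$ of positive integers let $-I=\{-k:k\in I\}$, $\pm I=I\cup(-I)$, and $\delta:k\mapsto -k$. A permutation of a set is taken to act trivially on all other integers, products of permutations act from right to left, and $\#(\pi)$ is the number of cycles of $\pi$ on its domain (fixed points included). A permutation $\pi$ of $\pm I$ is a *premap* if $\pi(k)=-\pi^{-1}(-k)$ for all $k\in\pm I$ and no cycle contains both $k$ and $-k$ for any $k$; $PM(\pm I)$ is the set of premaps on $\pm I$. For a premap $\sigma$, $\sigma/2$ denotes the set of its cycles whose element of smallest absolute value is positive. For $\gamma\in S(I)$ put $\gamma_+=\gamma$, $\gamma_-=\delta\gamma_+\delta$ and, for $\pi\in PM(\pm I)$, $$\chi(\gamma,\pi)=\tfrac12\#(\gamma_+\gamma_-^{-1})+\tfrac12\#(\pi)+\tfrac12\#(\gamma_+^{-1}\pi^{-1}\gamma_-)-|I|,$$ all counted on $\pm I$. For $\varepsilon:I\to\{1,-1\}$ put $\delta_\varepsilon(k)=\varepsilon(|k|)k$. For an $N\times N$ matrix, $\mathrm{tr}=\frac1N\mathrm{Tr}$, $A^{(1)}=A$, $A^{(-1)}=A^T$. For matrices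 $(Y_k)_{k\in I}$ write $Y^{(k)}=Y_k$ and $Y^{(-k)}=Y_k^T$, and let $\mathrm{tr}_\gamma(Y)$, resp. $\mathrm{tr}_{\sigma/2}(Y)$, be the product of $\mathrm{tr}(Y^{(c_1)}\cdots Y^{(c_m)})$ over the cycles $(c_1,\dots,c_m)$ of $\gamma$, resp. over the cycles in $\sigma/2$. Random matrices have complex (possibly real) entries with finite moments of all orders and are all defined on one probability space; $\mathring A=A-\mathbb E(\mathrm{tr}(A))$. **Premap expansion.** Let $\{X^{(\lambda)}\}_{\lambda\in\Lambda}$ be an ensemble of random matrices, that is, for every $N=1,2,\dots$ a family of random $N\times N$ matrices indexed by $\Lambda$. It satisfies the premap expansion if for every finite set $I$ of positive integers there are a set $PM_c(\pm I)\subseteq PM(\pm I)$ and complex coefficients $f_c(\pi)$, $\pi\in PM_c(\pm I)$, which may depend on $N$ and on the labels $\lambda_k\in\Lambda$, such that: 1. for all $N$, all $I$, all $\gamma\in S(I)$, $\varepsilon:I\to\{1,-1\}$, labels $\lambda_k$, and all random $N\times N$ matrices $(Y_k)_{k\in I}$ that are jointly independent of the ensemble, $$\mathbb E\Big(\mathrm{tr}_\gamma\big((X^{(\lambda_k)})^{(\varepsilon(k))}Y_k\big)_{k\in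 I}\Big)=\sum_{\pi\in PM_c(\pm I)}N^{\chi(\gamma,\delta_\varepsilon\pi\delta_\varepsilon)-2\#(\gamma)}\,f_c(\pi)\,\mathbb E\Big(\mathrm{tr}_{\gamma_-^{-1}\delta_\varepsilon\pi\delta_\varepsilon\gamma_+/2}(Y)\Big);$$ 2. for all $J\subseteq I$, the $\pi\in PM_c(\pm I)$ that have no cycle meeting both $\pm J$ and $\pm(I\setminus J)$ are exactly the products $\pi_1\pi_2$ with $\pi_1\in PM_c(\pm J)$ and $\pi_2\in PM_c(\pm(I\setminus J))$; 3. for fixed $I$, labels and $\pi\in PM_c(\pm I)$, $\lim_{N\to\infty}f_c(\pi)$ exists; 4. ($f_c$ is multiplicative) in the situation of 2, $f_c(\pi_1\pi_2)=f_c(\pi_1)f_c(\pi_2)$. **Lemma 5.1.** For each colour $c\in[C]=\{1,\dots,C\}$ let $\{X_c^{(\lambda)}\}_{\lambda\in\Lambda_c}$ be an ensemble of random matrices that satisfies the premap expansion (with its own $PM_c$ and $f_c$), and suppose that for each $N$ the ensembles of the different colours are (mutually) independent. Then the ensembles are asymptotically free: for every $p\ge1$, every word $w:[p]\to[C]$ with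 $w(i)\ne w(i+1)$ for $1\le i<p$, and all $A_1,\dots,A_p$, where $A_i$ is a fixed (independent of $N$) noncommutative polynomial with complex coefficients in the matrices $X_{w(i)}^{(\lambda)}$ and their transposes, $\lambda\in\Lambda_{w(i)}$, $$\lim_{N\to\infty}\mathbb E\big(\mathrm{tr}(\mathring A_1\cdots\mathring A_p)\big)=0.$$ -/

import Mathlib

/-! Random matrices whose mixed moments have an expansion over premaps, and asymptotic freeness.

Labels of matrices are positive integers; a finite set `I` of positive integers is a `Finset ℤ`.
A permutation of a finite set `A` of integers is a permutation of `ℤ` that acts trivially off `A`;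
whenever a number depends on the domain, the domain is given explicitly. -/

namespace PremapFreeness

open Equiv MeasureTheory ProbabilityTheory Filter Topology

/-- `±I = I ∪ (-I)`. -/
def signedSet (I : Finset ℤ) : Finset ℤ := I ∪ I.image (fun k => -k)

/-- `π ∈ S(A)`. -/
def IsPermOn (A : Finset ℤ) (π : Perm ℤ) : Prop := ∀ k, k ∉ A → π k = k

/-- `#(π)`: the number of cycles (fixed points included) of `π`, as a permutation of `A`. -/
noncomputable def numCycles (A : Finset ℤ) (π : Perm ℤ) : ℕ :=
  ((fun k => {m : ℤ | π.SameCycle k m}) '' (A : Set ℤ)).ncard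

/-- `δ : k ↦ -k`. -/
def delta : Perm ℤ := Equiv.neg ℤ

/-- `δ_ε : k ↦ ε(k) k`, where `ε(-k) = ε(k)`. -/
def deltaEps (ε : ℤ → ℤˣ) : Perm ℤ :=
  Function.Involutive.toPerm (fun k => (ε |k| : ℤ) * k) (by
    intro k
    have h : |(ε |k| : ℤ) * k| = |k| := by
      rcases Int.units_eq_one_or (ε |k|) with h | h <;> simp [h]
    show (ε |(ε |k| : ℤ) * k| : ℤ) * ((ε |k| : ℤ) * k) = k
    rw [h, ← mul_assoc]
    rcases Int.units_eq_one_or (ε |k|) with h | h <;> simp [h])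

/-- `γ₋ = δ γ₊ δ`; the permutation `γ₊` is `γ` itself, acting trivially off its domain. -/
def minusPart (γ : Perm ℤ) : Perm ℤ := delta * γ * delta

/-- `π ∈ PM(±I)`: `π(k) = -π⁻¹(-k)`, and no cycle contains both `k` and `-k`. -/
def IsPremap (I : Finset ℤ) (π : Perm ℤ) : Prop :=
  IsPermOn (signedSet I) π ∧
    ∀ k ∈ signedSet I, π k = -(π⁻¹ (-k)) ∧ ¬ π.SameCycle k (-k)

/-- `π` has a cycle that contains an element of `A` and an element of `B`. -/
def Connects (π : Perm ℤ) (A B : Finset ℤ) : Prop :=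
  ∃ a ∈ A, ∃ b ∈ B, π.SameCycle a b

/-- `χ(γ, π) = #(γ₊γ₋⁻¹)/2 + #(π)/2 + #(γ₊⁻¹π⁻¹γ₋)/2 - |I|` for `γ ∈ S(I)` and `π ∈ PM(±I)`.
The three permutations are premaps on `±I`, so their numbers of cycles are even. -/
noncomputable def eulerChar (I : Finset ℤ) (γ π : Perm ℤ) : ℤ :=
  ((numCycles (signedSet I) (γ * (minusPart γ)⁻¹) / 2 : ℕ) : ℤ)
    + ((numCycles (signedSet I) π / 2 : ℕ) : ℤ)
    + ((numCycles (signedSet I) (γ⁻¹ * π⁻¹ * minusPart γ) / 2 : ℕ) : ℤ)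
    - (I.card : ℤ)

/-- The normalized trace `tr = (1/N) Tr`. -/
noncomputable def ntr {N : ℕ} (A : Matrix (Fin N) (Fin N) ℂ) : ℂ := (N : ℂ)⁻¹ * A.trace

/-- `A^{(1)} = A` and `A^{(-1)} = Aᵀ` (transpose, without complex conjugation). -/
def signedMatrix {N : ℕ} (s : ℤˣ) (A : Matrix (Fin N) (Fin N) ℂ) :
    Matrix (Fin N) (Fin N) ℂ :=
  if s = 1 then A else A.transpose

/-- For a family `Y` labelled by positive integers: `Y^{(k)} = Y_k` and `Y^{(-k)} = Y_kᵀ`, `k > 0`. -/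
def atSigned {N : ℕ} (Y : ℤ → Matrix (Fin N) (Fin N) ℂ) (j : ℤ) : Matrix (Fin N) (Fin N) ℂ :=
  if 0 < j then Y j else (Y (-j)).transpose

/-- `Y^{(k)} Y^{(σ(k))} Y^{(σ²(k))} ⋯`, once around the cycle of `σ` that contains `k`. -/
noncomputable def cycleProduct {N : ℕ} (σ : Perm ℤ) (k : ℤ)
    (Y : ℤ → Matrix (Fin N) (Fin N) ℂ) : Matrix (Fin N) (Fin N) ℂ :=
  ((List.range (Function.minimalPeriod σ k)).map (fun i => atSigned Y ((σ ^ i) k))).prod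

open Classical in
/-- The product of the normalized traces along the particular cycles of `σ` that meet `I`, those
whose element of smallest absolute value is positive; each is listed from that element on.
For `σ = γ ∈ S(I)` all cycles are particular and this is `tr_γ(Y)`;
for a premap `σ` on `±I` it is `tr_{σ/2}(Y)`. -/
noncomputable def trAlong {N : ℕ} (I : Finset ℤ) (σ : Perm ℤ)
    (Y : ℤ → Matrix (Fin N) (Fin N) ℂ) : ℂ :=
  ∏ k ∈ I with ∀ j, σ.SameCycle k j → k ≤ |j|, ntr (cycleProduct σ k Y)

/-- A random `N × N` matrix whose entries have moments of all orders. -/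
def IsRandomMatrix {Ω : Type*} [MeasurableSpace Ω] (P : Measure Ω) {N : ℕ}
    (A : Ω → Matrix (Fin N) (Fin N) ℂ) : Prop :=
  ∀ i j, Measurable (fun ω => A ω i j) ∧ ∀ q : ℕ, MemLp (fun ω => A ω i j) q P

/-- The ensemble `X` (for each size `N` a family of random matrices indexed by `Λ`) satisfies the
premap expansion with sets of premaps `PM I ⊆ PM(±I)`, for `I` a finite set of positive integers,
and coefficients `f N l I π`, for `π ∈ PM I`. The coefficients may depend on the size `N` and on
the labels `l k` of the matrices at the positions `k`. -/
structure HasPremapExpansion {Ω Λ : Type*} [MeasurableSpace Ω] (P : Measure Ω)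
    (X : (N : ℕ) → Λ → Ω → Matrix (Fin N) (Fin N) ℂ)
    (PM : Finset ℤ → Finset (Perm ℤ))
    (f : ℕ → (ℤ → Λ) → Finset ℤ → Perm ℤ → ℂ) : Prop where
  isRandomMatrix : ∀ N, 0 < N → ∀ l, IsRandomMatrix P (X N l)
  isPremap : ∀ I : Finset ℤ, (∀ k ∈ I, 0 < k) → ∀ π ∈ PM I, IsPremap I π
  /-- `E tr_γ(X_{l 1}^{(ε 1)} Y₁, X_{l 2}^{(ε 2)} Y₂, …)
  = ∑_π N^{χ(γ, δ_ε π δ_ε) - 2#(γ)} f(π) E tr_{γ₋⁻¹ δ_ε π δ_ε γ₊ / 2}(Y₁, Y₂, …)`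
  for random matrices `Y` that are independent of the ensemble. -/
  expansion : ∀ N, 0 < N → ∀ I : Finset ℤ, (∀ k ∈ I, 0 < k) →
    ∀ γ : Perm ℤ, IsPermOn I γ → ∀ (ε : ℤ → ℤˣ) (l : ℤ → Λ)
      (Y : ℤ → Ω → Matrix (Fin N) (Fin N) ℂ), (∀ k, IsRandomMatrix P (Y k)) →
      IndepFun (fun ω (a : Λ) (i j : Fin N) => X N a ω i j)
        (fun ω (k : ℤ) (i j : Fin N) => Y k ω i j) P →
      ∫ ω, trAlong I γ (fun k => signedMatrix (ε k) (X N (l k) ω) * Y k ω) ∂P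
        = ∑ π ∈ PM I,
            (N : ℂ) ^ (eulerChar I γ (deltaEps ε * π * deltaEps ε) - 2 * (numCycles I γ : ℤ))
              * f N l I π
              * ∫ ω, trAlong I ((minusPart γ)⁻¹ * (deltaEps ε * π * deltaEps ε) * γ)
                  (fun k => Y k ω) ∂P
  /-- The elements of `PM I` that do not connect `±J` and `±(I \ J)` are exactly the products of
  an element of `PM J` and an element of `PM (I \ J)`. -/
  product : ∀ I : Finset ℤ, (∀ k ∈ I, 0 < k) → ∀ J ⊆ I, ∀ π : Perm ℤ,
    (π ∈ PM I ∧ ¬ Connects π (signedSet J) (signedSet (I \ J))) ↔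
      ∃ π₁ ∈ PM J, ∃ π₂ ∈ PM (I \ J), π = π₁ * π₂
  tendsto : ∀ I : Finset ℤ, (∀ k ∈ I, 0 < k) → ∀ l : ℤ → Λ, ∀ π ∈ PM I,
    ∃ L : ℂ, Tendsto (fun N => f N l I π) atTop (𝓝 L)
  /-- `f` is multiplicative: here `π₁` and `π₂` are the restrictions of `π₁ π₂` to `±J` and to
  `±(I \ J)`. -/
  multiplicative : ∀ N, 0 < N → ∀ I : Finset ℤ, (∀ k ∈ I, 0 < k) → ∀ J ⊆ I, ∀ l : ℤ → Λ,
    ∀ π₁ ∈ PM J, ∀ π₂ ∈ PM (I \ J), f N l I (π₁ * π₂) = f N l J π₁ * f N l (I \ J) π₂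

/-- The random matrix `a(Z)`, for a noncommutative polynomial `a` in the family `Z`. -/
noncomputable def evalPoly {Ω Λ : Type*} {N : ℕ} (Z : Λ → Ω → Matrix (Fin N) (Fin N) ℂ)
    (a : FreeAlgebra ℂ Λ) (ω : Ω) : Matrix (Fin N) (Fin N) ℂ :=
  FreeAlgebra.lift ℂ (fun l => Z l ω) a

/-- `Å = A - E(tr A)`. -/
noncomputable def centred {Ω : Type*} [MeasurableSpace Ω] (P : Measure Ω) {N : ℕ}
    (A : Ω → Matrix (Fin N) (Fin N) ℂ) (ω : Ω) : Matrix (Fin N) (Fin N) ℂ :=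
  A ω - (∫ ω', ntr (A ω') ∂P) • (1 : Matrix (Fin N) (Fin N) ℂ)

/-- Asymptotic freeness of families `X c` of random matrices, `c` a colour. An element of the
algebra generated by a family is a fixed noncommutative polynomial in it, the same for all `N`. -/
def AsymptoticallyFree {Ω κ : Type*} [MeasurableSpace Ω] (P : Measure Ω) {Λ : κ → Type*}
    (X : (c : κ) → (N : ℕ) → Λ c → Ω → Matrix (Fin N) (Fin N) ℂ) : Prop :=
  ∀ (p : ℕ), 0 < p → ∀ w : Fin p → κ,
    (∀ i j : Fin p, (j : ℕ) = (i : ℕ) + 1 → w i ≠ w j) →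
    ∀ a : (i : Fin p) → FreeAlgebra ℂ (Λ (w i)),
      Tendsto
        (fun N : ℕ => ∫ ω, ntr
          ((List.ofFn (fun i => centred P (evalPoly (X (w i) N) (a i)) ω)).prod) ∂P)
        atTop (𝓝 0)

end PremapFreeness

namespace PremapFreeness

open Equiv MeasureTheory ProbabilityTheory Filter Topology

/-! ### Cycles of premaps -/

/-! With γ and all signs trivial and with deterministic matrix units for the `Y k`, the expansion
becomes a formula for the mixed moments of entries (`HasPremapExpansion.integral_prod_entries`): a
sum over premaps of N^(#(π)/2 - |I|) f(π) times the indicator that the 2|I| indices agree along the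
perfect matching `a ↔ π (-a)`. The rest of the proof works with such indicators; three of their
features matter.

Invariance. A product of Kronecker deltas is invariant under simultaneous rotation of its indices.
By independence the joint moments are invariant under rotating the indices of one colour only
(`moment_rotationInvariant`). Contracting the infinitesimal form over all coordinate planes gives a
loop equation (`expectation_splitSum_eq`): for each colour, a combination of expected products of
two traces equals a combination of expected single traces.

Size. The coefficient of a matching is at most a constant times the share of diagonal assignments
among those it allows (`card_respecting_premapRel_le`). This bound survives products over disjoint
positions (`IsAtom.mul`). As `Fin (N + 1)` is a group, the assignments form groups, and comparing
subgroup indices reduces a sum over closed paths to a count of constant paths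
(`exists_norm_sum_le`). Hence the expected unnormalized trace of a word is O(N).

Factorization. In a moment minus a product of two moments, multiplicativity cancels every premap
that does not connect the two sets of positions. The surviving ones force two constant paths to
coincide, so the covariance of two unnormalized traces is O(N): crude, but o(N²).

After division by N², with τ the mean normalized trace, the loop equation reads: the sum of τ(Q)
τ(pR) - τ(Qp) τ(R), over the factorizations QpR of a product with p a factor of the given colour,
tends to 0 (`tendsto_splitLim`). `HasMomentExpansion.tendsto_meanTrace` inducts on the length of an
alternating centred product. If the end colours differ, the equation for the colour of the last
factor contains the whole product once, with coefficient -1, and otherwise only shorter ones. If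
they agree, traciality merges the two ends, and recentring leaves shorter products. -/

theorem mem_signedSet {I : Finset ℤ} {a : ℤ} : a ∈ signedSet I ↔ a ∈ I ∨ -a ∈ I := by
  simp only [signedSet, Finset.mem_union, Finset.mem_image]
  refine or_congr Iff.rfl ⟨?_, fun h => ⟨-a, h, neg_neg a⟩⟩
  rintro ⟨b, hb, rfl⟩
  simpa using hb

theorem neg_mem_signedSet {I : Finset ℤ} {a : ℤ} : -a ∈ signedSet I ↔ a ∈ signedSet I := by
  rw [mem_signedSet, mem_signedSet, neg_neg, or_comm]

theorem IsPermOn.apply_mem {A : Finset ℤ} {π : Perm ℤ} (h : IsPermOn A π) {a : ℤ} :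
    π a ∈ A ↔ a ∈ A := by
  by_cases ha : a ∈ A
  · refine ⟨fun _ => ha, fun _ => ?_⟩
    by_contra hc
    have h1 := h _ hc
    exact hc ((π.injective h1).symm ▸ ha)
  · rw [h a ha]

theorem IsPermOn.zpow_apply_mem {A : Finset ℤ} {π : Perm ℤ} (h : IsPermOn A π) {a : ℤ} (i : ℤ) :
    (π ^ i) a ∈ A ↔ a ∈ A := by
  induction i with
  | zero => simp
  | succ i ih => rw [add_comm, zpow_add, Perm.mul_apply, zpow_one, h.apply_mem, ih]
  | pred i ih =>
    rw [← h.apply_mem, ← ih, ← Perm.mul_apply, ← zpow_one_add]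
    congr! 3
    ring

theorem IsPermOn.mem_of_sameCycle {A : Finset ℤ} {π : Perm ℤ} (h : IsPermOn A π) {a b : ℤ}
    (hab : π.SameCycle a b) : a ∈ A ↔ b ∈ A := by
  obtain ⟨i, rfl⟩ := hab
  exact (h.zpow_apply_mem i).symm

theorem IsPremap.inv_neg {I : Finset ℤ} {π : Perm ℤ} (h : IsPremap I π) (k : ℤ) :
    π⁻¹ (-k) = -π k := by
  by_cases hk : k ∈ signedSet I
  · rw [(h.2 k hk).1, neg_neg]
  · have hk' : -k ∉ signedSet I := fun h' => hk (neg_mem_signedSet.1 h')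
    rw [Perm.inv_eq_iff_eq, h.1 k hk, h.1 _ hk']

/-- This makes `a ↦ π (-a)` an involution. It has no fixed point on ±I, since no cycle contains both
`a` and `-a`; so a premap is a perfect matching of ±I. -/
theorem IsPremap.apply_neg_apply {I : Finset ℤ} {π : Perm ℤ} (h : IsPremap I π) (k : ℤ) :
    π (-π k) = -k := by
  exact (Perm.inv_eq_iff_eq.1 (h.inv_neg k)).symm

/-- The premap condition says that `π⁻¹` is the conjugate of `π` by `delta`, and `π⁻¹` has the same
cycles as `π`. -/
theorem IsPremap.sameCycle_neg {I : Finset ℤ} {π : Perm ℤ} (h : IsPremap I π) {a b : ℤ} :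
    π.SameCycle (-a) (-b) ↔ π.SameCycle a b := by
  have h1 : π⁻¹ = delta * π * delta⁻¹ := by
    ext k
    have h2 : (delta⁻¹ : Perm ℤ) k = -k := by
      rw [Perm.inv_eq_iff_eq]; simp [delta]
    rw [Perm.mul_apply, Perm.mul_apply, h2]
    have := h.inv_neg (-k)
    rw [neg_neg] at this
    rw [this]; rfl
  have h2 : ∀ k : ℤ, (delta⁻¹ : Perm ℤ) k = -k := fun k => by
    rw [Perm.inv_eq_iff_eq]; simp [delta]
  rw [← Perm.sameCycle_inv (f := π) (x := a), h1, Perm.sameCycle_conj, h2, h2]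

open Classical in
/-- The starting points of the particular cycles of `π`. -/
noncomputable def particular (I : Finset ℤ) (π : Perm ℤ) : Finset ℤ :=
  {k ∈ I | ∀ j, π.SameCycle k j → k ≤ |j|}

theorem mem_particular {I : Finset ℤ} {π : Perm ℤ} {k : ℤ} :
    k ∈ particular I π ↔ k ∈ I ∧ ∀ j, π.SameCycle k j → k ≤ |j| := by
  simp [particular]

theorem particular_one {I : Finset ℤ} : particular I 1 = I := by
  ext k
  rw [mem_particular]
  refine ⟨fun h => h.1, fun h => ⟨h, fun j hj => ?_⟩⟩
  rw [Perm.sameCycle_one] at hj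
  rw [← hj]; exact le_abs_self k

/-- `k` lies in the cycle of `a` or in that of `-a`. -/
def SameCyclePair (π : Perm ℤ) (a k : ℤ) : Prop := π.SameCycle a k ∨ π.SameCycle (-a) k

theorem SameCyclePair.neg {π : Perm ℤ} {a k : ℤ} :
    SameCyclePair π (-a) k ↔ SameCyclePair π a k := by
  simp [SameCyclePair, or_comm]

theorem IsPremap.sameCyclePair_congr {I : Finset ℤ} {π : Perm ℤ} (h : IsPremap I π)
    {a b k : ℤ} (hab : π.SameCycle a b) : SameCyclePair π a k ↔ SameCyclePair π b k := by
  have hab' := h.sameCycle_neg.2 hab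
  exact or_congr ⟨fun hk => hab.symm.trans hk, fun hk => hab.trans hk⟩
    ⟨fun hk => hab'.symm.trans hk, fun hk => hab'.trans hk⟩

/-- Take an element of smallest absolute value in the cycle; if it is negative, pass to the mirror
cycle. -/
theorem IsPremap.exists_particular {I : Finset ℤ} (hI : ∀ k ∈ I, 0 < k) {π : Perm ℤ}
    (h : IsPremap I π) {a : ℤ} (ha : a ∈ signedSet I) :
    ∃ k ∈ particular I π, SameCyclePair π a k := by
  classical
  obtain ⟨j, hj, hmin⟩ := Finset.exists_min_image {j ∈ signedSet I | π.SameCycle a j}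
    (fun j => |j|) ⟨a, by simp [ha, Perm.SameCycle.refl]⟩
  simp only [Finset.mem_filter] at hj hmin
  rcases mem_signedSet.1 hj.1 with hjI | hjI
  · refine ⟨j, mem_particular.2 ⟨hjI, fun m hm => ?_⟩, Or.inl hj.2⟩
    rw [← abs_of_pos (hI j hjI)]
    exact hmin m ⟨(h.1.mem_of_sameCycle hm).1 hj.1, hj.2.trans hm⟩
  · refine ⟨-j, mem_particular.2 ⟨hjI, fun m hm => ?_⟩, Or.inr (h.sameCycle_neg.2 hj.2)⟩
    have hm' : π.SameCycle j (-m) := by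
      rw [← h.sameCycle_neg, neg_neg]; exact hm
    rw [← abs_of_pos (hI _ hjI), abs_neg, ← abs_neg m]
    exact hmin (-m) ⟨(h.1.mem_of_sameCycle hm').1 hj.1, hj.2.trans hm'⟩

theorem IsPremap.particular_unique {I : Finset ℤ} (hI : ∀ k ∈ I, 0 < k) {π : Perm ℤ}
    (h : IsPremap I π) {k k' : ℤ} (hk : k ∈ particular I π) (hk' : k' ∈ particular I π)
    (hkk : SameCyclePair π k k') : k = k' := by
  rw [mem_particular] at hk hk'
  have p := hI k hk.1
  have p' := hI k' hk'.1
  rcases hkk with hs | hs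
  · have h1 := hk.2 _ hs
    have h2 := hk'.2 _ hs.symm
    rw [abs_of_pos] at h1 h2 <;> omega
  · have h1 := hk.2 (-k') (by rw [← h.sameCycle_neg, neg_neg]; exact hs)
    have h2 := hk'.2 _ hs.symm
    rw [abs_neg, abs_of_pos] at h1 h2 <;> omega

theorem IsPremap.not_sameCycle_neg {I : Finset ℤ} {π : Perm ℤ}
    (h : IsPremap I π) (hI : ∀ k ∈ I, 0 < k) {k k' : ℤ} (hk : k ∈ particular I π)
    (hk' : k' ∈ particular I π) : ¬ π.SameCycle k (-k') := by
  intro hs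
  have : k = k' := h.particular_unique hI hk hk'
    (Or.inr (by rw [← h.sameCycle_neg, neg_neg]; exact hs))
  subst this
  exact (h.2 k (mem_signedSet.2 (Or.inl (mem_particular.1 hk).1))).2 hs

/-- Cycles come in mirror pairs of two distinct cycles, and exactly one cycle of each pair is
particular. -/
theorem IsPremap.numCycles_eq {I : Finset ℤ} (hI : ∀ k ∈ I, 0 < k) {π : Perm ℤ}
    (h : IsPremap I π) : numCycles (signedSet I) π = 2 * (particular I π).card := by
  classical
  set R := particular I π with hR
  set c : ℤ → Set ℤ := fun k => {m : ℤ | π.SameCycle k m} with hc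
  have hcc : ∀ k m, c k = c m ↔ π.SameCycle k m := by
    intro k m
    constructor
    · intro he
      have : m ∈ c k := by rw [he]; exact Perm.SameCycle.refl _ _
      exact this
    · intro hs
      ext x
      exact ⟨fun hx => hs.symm.trans hx, fun hx => hs.trans hx⟩
  have himg : c '' (signedSet I : Set ℤ) = c '' ((R ∪ R.image (fun k => -k) : Finset ℤ) : Set ℤ) := by
    apply Set.Subset.antisymm
    · rintro _ ⟨a, ha, rfl⟩
      obtain ⟨k, hk, hs⟩ := h.exists_particular hI ha
      rcases hs with hs | hs
      · exact ⟨k, by simp [hR, hk], ((hcc _ _).2 hs).symm⟩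
      · refine ⟨-k, by simp [hR, hk], ((hcc _ _).2 ?_).symm⟩
        rw [← h.sameCycle_neg, neg_neg]; exact hs
    · refine Set.image_mono ?_
      intro a ha
      simp only [Finset.coe_union, Finset.coe_image, Set.mem_union, Finset.mem_coe,
        Set.mem_image] at ha
      rw [Finset.mem_coe, mem_signedSet]
      rcases ha with ha | ⟨b, hb, rfl⟩
      · exact Or.inl (mem_particular.1 ha).1
      · rw [neg_neg]; exact Or.inr (mem_particular.1 hb).1
  have hinj : Set.InjOn c ((R ∪ R.image (fun k => -k) : Finset ℤ) : Set ℤ) := by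
    intro a ha b hb hab
    rw [hcc] at hab
    simp only [Finset.coe_union, Finset.coe_image, Set.mem_union, Finset.mem_coe,
        Set.mem_image] at ha hb
    rcases ha with ha | ⟨a, ha, rfl⟩ <;> rcases hb with hb | ⟨b, hb, rfl⟩
    · exact h.particular_unique hI ha hb (Or.inl hab)
    · exact (h.not_sameCycle_neg hI ha hb hab).elim
    · exact (h.not_sameCycle_neg hI hb ha hab.symm).elim
    · rw [h.particular_unique hI ha hb (Or.inl (h.sameCycle_neg.1 hab))]
  unfold numCycles
  rw [himg, hinj.ncard_image, Set.ncard_coe_finset, Finset.card_union_of_disjoint,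
    Finset.card_image_of_injective _ neg_injective, two_mul]
  rw [Finset.disjoint_left]
  intro a ha hb
  obtain ⟨b, hb', rfl⟩ := Finset.mem_image.1 hb
  have h1 := hI _ (mem_particular.1 ha).1
  have h2 := hI _ (mem_particular.1 hb').1
  omega

theorem isPremap_one {I : Finset ℤ} (hI : ∀ k ∈ I, 0 < k) : IsPremap I 1 := by
  refine ⟨fun k _ => rfl, fun k hk => ⟨by simp, ?_⟩⟩
  rw [Perm.sameCycle_one]
  rcases mem_signedSet.1 hk with h | h <;> have := hI _ h <;> omega

/-- For trivial γ the first cycle count cancels |I|, and the other two are those of `π` and `π⁻¹`.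
-/
theorem IsPremap.eulerChar_one {I : Finset ℤ} (hI : ∀ k ∈ I, 0 < k) {π : Perm ℤ}
    (h : IsPremap I π) : eulerChar I 1 π = 2 * ((particular I π).card : ℤ) := by
  have hm : minusPart 1 = 1 := by
    ext k; simp [minusPart, delta]
  have hi : numCycles (signedSet I) π⁻¹ = numCycles (signedSet I) π := by
    simp [numCycles, Perm.sameCycle_inv]
  unfold eulerChar
  rw [hm]
  simp only [inv_one, one_mul, mul_one]
  rw [hi, h.numCycles_eq hI, (isPremap_one hI).numCycles_eq hI, particular_one]
  simp only [Nat.mul_div_cancel_left _ (Nat.zero_lt_two)]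
  ring

theorem IsPermOn.minimalPeriod_pos {A : Finset ℤ} {π : Perm ℤ} (h : IsPermOn A π) (a : ℤ) :
    0 < Function.minimalPeriod π a := by
  by_cases ha : a ∈ A
  · have hf : Set.Finite (Set.range fun n : ℕ => (π ^ n) a) := by
      refine A.finite_toSet.subset ?_
      rintro _ ⟨n, rfl⟩
      have := (h.zpow_apply_mem (a := a) n).2 ha
      simpa using this
    have hni : ¬ Function.Injective (fun n : ℕ => (π ^ n) a) := fun hi =>
      Set.infinite_range_of_injective hi hf
    simp only [Function.Injective, not_forall] at hni
    obtain ⟨m, n, hmn, hne⟩ := hni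
    rw [Function.minimalPeriod_pos_iff_mem_periodicPts]
    wlog hlt : m < n generalizing m n
    · exact this n m hmn.symm (Ne.symm hne) (by omega)
    refine ⟨n - m, by omega, ?_⟩
    rw [Function.IsPeriodicPt, Function.IsFixedPt]
    have h2 : (π ^ m) ((π ^ (n - m)) a) = (π ^ m) a := by
      rw [← Perm.mul_apply, ← pow_add, Nat.add_sub_cancel' hlt.le]; exact hmn.symm
    have h3 := (π ^ m).injective h2
    rwa [← Perm.iterate_eq_pow] at h3
  · have : Function.minimalPeriod π a = 1 := Function.minimalPeriod_eq_one_iff_isFixedPt.2 (h a ha)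
    omega

theorem IsPermOn.exists_pow_apply_eq {A : Finset ℤ} {π : Perm ℤ} (h : IsPermOn A π) {a b : ℤ}
    (hab : π.SameCycle a b) : ∃ i < Function.minimalPeriod π a, (π ^ i) a = b := by
  obtain ⟨i, rfl⟩ := hab
  have hp := h.minimalPeriod_pos a
  set p := Function.minimalPeriod π a with hpd
  have hfix : (π ^ p) a = a := by
    rw [← Perm.iterate_eq_pow]; exact Function.isPeriodicPt_minimalPeriod π a
  refine ⟨(i % p).toNat, ?_, ?_⟩
  · have := Int.emod_lt_of_pos i (Int.natCast_pos.2 hp)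
    have := Int.emod_nonneg i (Int.natCast_ne_zero.2 hp.ne')
    omega
  · have h1 : ((i % p).toNat : ℤ) = i % p :=
      Int.toNat_of_nonneg (Int.emod_nonneg i (Int.natCast_ne_zero.2 hp.ne'))
    have h2 : (π ^ i) a = (π ^ (i % p)) ((π ^ ((p : ℤ) * (i / p))) a) := by
      rw [← Perm.mul_apply, ← zpow_add, Int.emod_add_mul_ediv]
    rw [h2, ← zpow_natCast, h1, zpow_mul, zpow_natCast,
      Perm.zpow_apply_eq_self_of_apply_eq_self hfix]

/-! ### Mixed moments of matrix entries -/

theorem prod_map_range_single {R : Type*} [CommRing R] {N : ℕ} (u v : ℕ → Fin N) (n : ℕ) :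
    ((List.range (n + 1)).map (fun i => Matrix.single (u i) (v i) (1 : R))).prod
      = Matrix.single (u 0) (v n) (if ∀ i < n, v i = u (i + 1) then 1 else 0) := by
  induction n with
  | zero => simp
  | succ n ih =>
    rw [List.range_succ, List.map_append, List.prod_append, ih]
    simp only [List.map_cons, List.map_nil, List.prod_cons, List.prod_nil, mul_one]
    by_cases h : v n = u (n + 1)
    · rw [h, Matrix.single_mul_single_same, mul_one]
      congr 1
      refine if_congr ⟨fun h' i hi => ?_, fun h' i hi => h' i (by omega)⟩ rfl rfl
      rcases Nat.lt_succ_iff_lt_or_eq.1 hi with hi | rfl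
      · exact h' i hi
      · exact h
    · rw [Matrix.single_mul_single_of_ne _ _ _ _ h, if_neg, Matrix.single_zero]
      exact fun h' => h (h' n (by omega))

/-- The matrix units that pick out the indices `s k`, `s (-k)`. -/
noncomputable def unitFamily {N : ℕ} (s : ℤ → Fin N) (k : ℤ) : Matrix (Fin N) (Fin N) ℂ :=
  Matrix.single (s k) (s (-k)) 1

theorem atSigned_unitFamily {N : ℕ} (s : ℤ → Fin N) (a : ℤ) :
    atSigned (unitFamily s) a = Matrix.single (s a) (s (-a)) 1 := by
  unfold atSigned unitFamily
  split_ifs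
  · rfl
  · rw [Matrix.transpose_single, neg_neg]

open Classical in
-- A product of matrix units survives only if each column index `s (-a)` equals the next row index
-- `s (π a)`; the trace adds the condition that closes the cycle.
theorem IsPermOn.ntr_cycleProduct_unitFamily {A : Finset ℤ} {π : Perm ℤ} (h : IsPermOn A π)
    {N : ℕ} (s : ℤ → Fin N) (k : ℤ) :
    ntr (cycleProduct π k (unitFamily s))
      = (N : ℂ)⁻¹ * if ∀ a, π.SameCycle k a → s (π a) = s (-a) then 1 else 0 := by
  obtain ⟨n, hn⟩ := Nat.exists_eq_succ_of_ne_zero (h.minimalPeriod_pos k).ne'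
  have hper : (π ^ (n + 1)) k = k := by
    rw [← Perm.iterate_eq_pow, ← Nat.succ_eq_add_one, ← hn]
    exact Function.isPeriodicPt_minimalPeriod π k
  unfold ntr cycleProduct
  simp only [atSigned_unitFamily]
  rw [hn, Nat.succ_eq_add_one,
    prod_map_range_single (fun i => s ((π ^ i) k)) (fun i => s (-(π ^ i) k))]
  congr 1
  simp only [pow_zero, Perm.one_apply]
  have key : (∀ a, π.SameCycle k a → s (π a) = s (-a)) ↔
      (∀ i < n, s (-(π ^ i) k) = s ((π ^ (i + 1)) k)) ∧ s (-(π ^ n) k) = s k := by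
    constructor
    · intro H
      refine ⟨fun i _ => ?_, ?_⟩
      · rw [pow_succ', Perm.mul_apply]
        exact (H _ ⟨i, by simp⟩).symm
      · have := H _ ⟨n, by rw [zpow_natCast]⟩
        rw [← Perm.mul_apply, ← pow_succ', hper] at this
        exact this.symm
    · rintro ⟨H1, H2⟩ a ha
      obtain ⟨i, hi, rfl⟩ := h.exists_pow_apply_eq ha
      rw [hn, Nat.lt_succ_iff_lt_or_eq] at hi
      rw [← Perm.mul_apply, ← pow_succ']
      rcases hi with hi | rfl
      · exact (H1 i hi).symm
      · rw [hper]; exact H2.symm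
  by_cases hk : s k = s (-(π ^ n) k)
  · rw [← hk, Matrix.trace_single_eq_same]
    exact if_congr (by rw [key]; simp [hk]) rfl rfl
  · rw [Matrix.trace_single_eq_of_ne _ _ _ hk, if_neg]
    rw [key]
    exact fun h' => hk h'.2.symm

open Classical in
theorem IsPremap.trAlong_unitFamily {I : Finset ℤ} (hI : ∀ k ∈ I, 0 < k) {π : Perm ℤ}
    (h : IsPremap I π) {N : ℕ} (s : ℤ → Fin N) :
    trAlong I π (unitFamily s)
      = ((N : ℂ)⁻¹) ^ (particular I π).card
        * if ∀ a ∈ signedSet I, s (π a) = s (-a) then 1 else 0 := by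
  have h1 : trAlong I π (unitFamily s)
      = ∏ k ∈ particular I π, ntr (cycleProduct π k (unitFamily s)) := by
    unfold trAlong particular
    rfl
  rw [h1]
  simp only [h.1.ntr_cycleProduct_unitFamily]
  rw [Finset.prod_mul_distrib, Finset.prod_const, Finset.prod_boole]
  congr 1
  refine if_congr ⟨fun H a ha => ?_, fun H k hk a hka => ?_⟩ rfl rfl
  · obtain ⟨k, hk, hs | hs⟩ := h.exists_particular hI ha
    · exact H k hk a hs.symm
    -- On the mirror of a particular cycle, the condition at `a` is the condition at `-π a` read
    -- backwards.
    · have h3 := H k hk (-π a) (by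
        have := h.sameCycle_neg (a := a) (b := π a)
        exact hs.symm.trans (this.2 ⟨1, by simp⟩))
      rw [h.apply_neg_apply, neg_neg] at h3
      exact h3.symm
  · refine H a ((h.1.mem_of_sameCycle hka).1 (mem_signedSet.2 (Or.inl (mem_particular.1 hk).1)))

open Classical in
/-- The mixed moments of the entries of an ensemble that satisfies the premap expansion. -/
theorem HasPremapExpansion.integral_prod_entries {Ω Λ : Type*} [MeasurableSpace Ω]
    {P : Measure Ω} [IsProbabilityMeasure P]
    {X : (N : ℕ) → Λ → Ω → Matrix (Fin N) (Fin N) ℂ} {PM : Finset ℤ → Finset (Perm ℤ)}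
    {f : ℕ → (ℤ → Λ) → Finset ℤ → Perm ℤ → ℂ} (hX : HasPremapExpansion P X PM f)
    {N : ℕ} (hN : 0 < N) {I : Finset ℤ} (hI : ∀ k ∈ I, 0 < k) (l : ℤ → Λ) (s : ℤ → Fin N) :
    ∫ ω, ∏ k ∈ I, X N (l k) ω (s (-k)) (s k) ∂P
      = ∑ π ∈ PM I, (N : ℂ) ^ (((particular I π).card : ℤ) - I.card) * f N l I π
          * if ∀ a ∈ signedSet I, s (π a) = s (-a) then 1 else 0 := by
  have hN' : (N : ℂ) ≠ 0 := Nat.cast_ne_zero.2 hN.ne'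
  have hm : minusPart 1 = 1 := by
    ext k; simp [minusPart, delta]
  have hd : deltaEps (fun _ => 1) = 1 := by
    ext k; simp [deltaEps]
  have hY : ∀ k, IsRandomMatrix P (fun _ : Ω => unitFamily s k) := fun k i j =>
    ⟨measurable_const, fun q => memLp_const _⟩
  -- For trivial γ the left side is a product of |I| traces, and each matrix unit picks out a single
  -- entry.
  have H := hX.expansion N hN I hI 1 (fun _ _ => rfl) (fun _ => 1) l
    (fun k _ => unitFamily s k) hY (indepFun_const_right _ _)
  have hL : ∀ ω, trAlong I 1 (fun k => signedMatrix 1 (X N (l k) ω) * unitFamily s k)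
      = ((N : ℂ)⁻¹) ^ I.card * ∏ k ∈ I, X N (l k) ω (s (-k)) (s k) := by
    intro ω
    have h1 : trAlong I 1 (fun k => signedMatrix 1 (X N (l k) ω) * unitFamily s k)
        = ∏ k ∈ particular I 1, ntr (cycleProduct 1 k
          (fun k => signedMatrix 1 (X N (l k) ω) * unitFamily s k)) := rfl
    rw [h1, particular_one, ← Finset.prod_const, ← Finset.prod_mul_distrib]
    refine Finset.prod_congr rfl fun k hk => ?_
    have h2 : Function.minimalPeriod (1 : Perm ℤ) k = 1 :=
      Function.minimalPeriod_eq_one_iff_isFixedPt.2 rfl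
    unfold ntr cycleProduct
    rw [h2]
    simp [atSigned, hI k hk, signedMatrix, unitFamily, Matrix.trace_mul_single]
  simp only [hL, hm, hd, inv_one, one_mul, mul_one, integral_const, probReal_univ, one_smul] at H
  rw [integral_const_mul] at H
  have hn : numCycles I 1 = I.card := by
    unfold numCycles
    simp only [Perm.sameCycle_one]
    rw [Set.InjOn.ncard_image, Set.ncard_coe_finset]
    intro a _ b _ hab
    exact hab.ge (rfl : b = b)
  rw [inv_pow, inv_mul_eq_iff_eq_mul₀ (pow_ne_zero _ hN')] at H
  rw [H, Finset.mul_sum]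
  refine Finset.sum_congr rfl fun π hπ => ?_
  have hp := hX.isPremap I hI π hπ
  -- With R particular cycles, the powers of N are 2R - 2|I| from the expansion, -R from the traces
  -- on the right and |I| from the normalized traces on the left.
  rw [hp.eulerChar_one hI, hp.trAlong_unitFamily hI, hn,
    show ∀ a b c d e : ℂ, a * (b * c * (d * e)) = a * b * d * c * e by intros; ring,
    inv_pow, ← zpow_natCast, ← zpow_natCast, ← zpow_neg, ← zpow_add₀ hN', ← zpow_add₀ hN']
  congr 3
  ring

/-! ### Functions of index assignments that are spanned by indicators of identifications

A random matrix at the position `k : ι` has the two indices `(k, false)` and `(k, true)`. -/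

section IndexAssignments

variable {ι : Type*}

/-- The index assignments that take equal values on related indices. -/
def respecting (N : ℕ) (r : ι × Bool → ι × Bool → Prop) :
    AddSubgroup (ι × Bool → Fin (N + 1)) where
  carrier := {s | ∀ a b, r a b → s a = s b}
  zero_mem' := fun _ _ _ => rfl
  add_mem' := fun hs ht a b hab => by
    simp only [Pi.add_apply, hs a b hab, ht a b hab]
  neg_mem' := fun hs a b hab => by
    simp only [Pi.neg_apply, hs a b hab]

/-- The index assignments whose two indices at every position of `I` agree. -/
def diagonal (N : ℕ) (I : Finset ι) : AddSubgroup (ι × Bool → Fin (N + 1)) :=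
  respecting N (fun a b => a.1 ∈ I ∧ a.1 = b.1)

theorem mem_diagonal {N : ℕ} {I : Finset ι} {s : ι × Bool → Fin (N + 1)} :
    s ∈ diagonal N I ↔ ∀ k ∈ I, s (k, false) = s (k, true) := by
  refine ⟨fun h k hk => h _ _ ⟨hk, rfl⟩, fun h => ?_⟩
  rintro ⟨k, b⟩ ⟨k', b'⟩ ⟨hk, hkk⟩
  obtain rfl : k = k' := hkk
  have := h k hk
  cases b <;> cases b' <;> simp_all

theorem respecting_sup {N : ℕ} (r r' : ι × Bool → ι × Bool → Prop) :
    respecting N (r ⊔ r') = respecting N r ⊓ respecting N r' := by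
  ext s
  rw [AddSubgroup.mem_inf]
  exact ⟨fun h => ⟨fun a b hab => h a b (Or.inl hab), fun a b hab => h a b (Or.inr hab)⟩,
    fun h a b hab => hab.elim (h.1 a b) (h.2 a b)⟩

theorem diagonal_union [DecidableEq ι] {N : ℕ} (I I' : Finset ι) :
    diagonal N (I ∪ I') = diagonal N I ⊓ diagonal N I' := by
  ext s
  simp only [AddSubgroup.mem_inf, mem_diagonal, Finset.mem_union]
  exact ⟨fun h => ⟨fun k hk => h k (Or.inl hk), fun k hk => h k (Or.inr hk)⟩,
    fun h k hk => hk.elim (h.1 k) (h.2 k)⟩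

open Classical in
/-- The function `b(N)` times the indicator of the assignments that respect `r`. -/
noncomputable def atom (r : ι × Bool → ι × Bool → Prop) (b : ℕ → ℂ) :
    (N : ℕ) → (ι × Bool → Fin (N + 1)) → ℂ :=
  fun N s => if s ∈ respecting N r then b N else 0

/-- The relation `r` only involves the positions `I`, and the size of the coefficient `b` is at
most a constant times the share of diagonal assignments among those that respect `r`. -/
def IsAtom (I : Finset ι) (r : ι × Bool → ι × Bool → Prop) (b : ℕ → ℂ) : Prop :=
  (∀ x y, r x y → x.1 ∈ I ∧ y.1 ∈ I) ∧
    ∃ K : ℝ, ∀ N, ‖b N‖ * Nat.card (respecting N r)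
      ≤ K * Nat.card ↥(respecting N r ⊓ diagonal N I)

/-- The span of the atoms on the positions `I` whose relation satisfies `Q`. -/
def atomSpan (I : Finset ι) (Q : (ι × Bool → ι × Bool → Prop) → Prop) :
    Submodule ℂ ((N : ℕ) → (ι × Bool → Fin (N + 1)) → ℂ) :=
  Submodule.span ℂ {F | ∃ r b, IsAtom I r b ∧ Q r ∧ F = atom r b}

theorem atom_mem_atomSpan {I : Finset ι} {Q : (ι × Bool → ι × Bool → Prop) → Prop}
    {r : ι × Bool → ι × Bool → Prop} {b : ℕ → ℂ} (h : IsAtom I r b) (hQ : Q r) :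
    atom r b ∈ atomSpan I Q :=
  Submodule.subset_span ⟨r, b, h, hQ, rfl⟩

theorem atomSpan_mono {I : Finset ι} {Q Q' : (ι × Bool → ι × Bool → Prop) → Prop}
    (h : ∀ r, (∀ x y, r x y → x.1 ∈ I ∧ y.1 ∈ I) → Q r → Q' r) :
    atomSpan I Q ≤ atomSpan I Q' := by
  refine Submodule.span_mono ?_
  rintro _ ⟨r, b, hr, hQ, rfl⟩
  exact ⟨r, b, hr, h r hr.1 hQ, rfl⟩

theorem one_mem_atomSpan : (1 : (N : ℕ) → (ι × Bool → Fin (N + 1)) → ℂ) ∈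
    atomSpan (∅ : Finset ι) (fun _ => True) := by
  have h : (1 : (N : ℕ) → (ι × Bool → Fin (N + 1)) → ℂ) = atom ⊥ 1 := by
    funext N s
    have : s ∈ respecting N ⊥ := fun _ _ h => h.elim
    simp [atom, this]
  rw [h]
  refine atom_mem_atomSpan ⟨fun _ _ h => h.elim, 1, fun N => ?_⟩ trivial
  have : diagonal N (∅ : Finset ι) = ⊤ := by
    rw [eq_top_iff]; intro s _; rw [mem_diagonal]; simp
  simp [this]

/-- Conditions on complementary sets of coordinates are independent for the counting measure. -/
theorem card_inter_mul_card {H F : Type*} (S : Set H) (A B : Set (H → F))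
    (hA : ∀ s t : H → F, (∀ a ∈ S, s a = t a) → s ∈ A → t ∈ A)
    (hB : ∀ s t : H → F, (∀ a ∉ S, s a = t a) → s ∈ B → t ∈ B) :
    Nat.card ↥(A ∩ B) * Nat.card (H → F) = Nat.card A * Nat.card B := by
  classical
  rw [← Nat.card_prod, ← Nat.card_prod]
  refine Nat.card_congr
    { toFun := fun p => (⟨S.piecewise p.1.1 p.2, hA _ _ (fun a ha => by simp [ha]) p.1.2.1⟩,
        ⟨S.piecewise p.2 p.1.1, hB _ _ (fun a ha => by simp [ha]) p.1.2.2⟩)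
      invFun := fun p => (⟨S.piecewise p.1.1 p.2.1, hA _ _ (fun a ha => by simp [ha]) p.1.2,
        hB _ _ (fun a ha => by simp [ha]) p.2.2⟩, S.piecewise p.2.1 p.1.1)
      left_inv := ?_
      right_inv := ?_ }
  · rintro ⟨⟨s, hs⟩, t⟩
    refine Prod.ext (Subtype.ext ?_) ?_ <;> funext a <;> by_cases ha : a ∈ S <;> simp [ha]
  · rintro ⟨⟨s, hs⟩, ⟨t, ht⟩⟩
    refine Prod.ext (Subtype.ext ?_) (Subtype.ext ?_) <;> funext a <;>
      by_cases ha : a ∈ S <;> simp [ha]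

/-- Conditions on disjoint positions are independent for the counting measure, so the number of
respecting assignments and the number of diagonal ones among them both factor, up to the same total
number of assignments. -/
theorem IsAtom.mul [Fintype ι] [DecidableEq ι] {I I' : Finset ι} (hI : Disjoint I I')
    {r r' : ι × Bool → ι × Bool → Prop} {b b' : ℕ → ℂ} (h : IsAtom I r b)
    (h' : IsAtom I' r' b') : IsAtom (I ∪ I') (r ⊔ r') (b * b') := by
  obtain ⟨hr, K, hK⟩ := h
  obtain ⟨hr', K', hK'⟩ := h'
  refine ⟨fun x y hxy => ?_, K * K', fun N => ?_⟩
  · rcases hxy with hxy | hxy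
    · exact ⟨Finset.mem_union_left _ (hr x y hxy).1, Finset.mem_union_left _ (hr x y hxy).2⟩
    · exact ⟨Finset.mem_union_right _ (hr' x y hxy).1, Finset.mem_union_right _ (hr' x y hxy).2⟩
  have hnot : ∀ x : ι × Bool, x.1 ∈ I' → x.1 ∉ I := fun x hx hx' =>
    Finset.disjoint_left.1 hI hx' hx
  have key : ∀ q q' : ι × Bool → ι × Bool → Prop, (∀ x y, q x y → x.1 ∈ I ∧ y.1 ∈ I) →
      (∀ x y, q' x y → x.1 ∈ I' ∧ y.1 ∈ I') →
      Nat.card ↥(respecting N q ⊓ respecting N q') * Nat.card (ι × Bool → Fin (N + 1))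
        = Nat.card ↥(respecting N q) * Nat.card ↥(respecting N q') := by
    intro q q' hq hq'
    refine card_inter_mul_card {x : ι × Bool | x.1 ∈ I}
      (respecting N q : Set (ι × Bool → Fin (N + 1)))
      (respecting N q' : Set (ι × Bool → Fin (N + 1))) (fun s t hst hs x y hxy => ?_) (fun s t hst hs x y hxy => ?_)
    · rw [← hst x (hq x y hxy).1, ← hst y (hq x y hxy).2]; exact hs x y hxy
    · rw [← hst x (hnot _ (hq' x y hxy).1), ← hst y (hnot _ (hq' x y hxy).2)]; exact hs x y hxy
  have k1 := key r r' hr hr'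
  -- Diagonality is itself a relation on the positions, so the same factorization applies to the
  -- diagonal assignments.
  have k2 := key (r ⊔ fun a b => a.1 ∈ I ∧ a.1 = b.1) (r' ⊔ fun a b => a.1 ∈ I' ∧ a.1 = b.1)
    (fun x y hxy => hxy.elim (hr x y) (fun h => ⟨h.1, h.2 ▸ h.1⟩))
    (fun x y hxy => hxy.elim (hr' x y) (fun h => ⟨h.1, h.2 ▸ h.1⟩))
  rw [respecting_sup, respecting_sup, ← diagonal, ← diagonal, inf_inf_inf_comm,
    ← diagonal_union, ← respecting_sup] at k2
  rw [← respecting_sup] at k1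
  have hT : (0 : ℝ) < Nat.card (ι × Bool → Fin (N + 1)) := Nat.cast_pos.2 Nat.card_pos
  refine le_of_mul_le_mul_right ?_ hT
  rw [mul_assoc, mul_assoc, ← Nat.cast_mul, ← Nat.cast_mul, k1, k2, Pi.mul_apply, norm_mul]
  push_cast
  calc ‖b N‖ * ‖b' N‖ * (Nat.card ↥(respecting N r) * Nat.card ↥(respecting N r'))
      = (‖b N‖ * Nat.card ↥(respecting N r)) * (‖b' N‖ * Nat.card ↥(respecting N r')) := by ring
    _ ≤ (K * Nat.card ↥(respecting N r ⊓ diagonal N I))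
          * (K' * Nat.card ↥(respecting N r' ⊓ diagonal N I')) :=
        mul_le_mul (hK N) (hK' N) (by positivity) (le_trans (by positivity) (hK N))
    _ = _ := by ring

theorem atom_mul (r r' : ι × Bool → ι × Bool → Prop) (b b' : ℕ → ℂ) :
    atom r b * atom r' b' = atom (r ⊔ r') (b * b') := by
  funext N s
  have h0 : s ∈ respecting N (r ⊔ r') ↔ s ∈ respecting N r ∧ s ∈ respecting N r' := by
    rw [respecting_sup, AddSubgroup.mem_inf]
  simp only [Pi.mul_apply, atom]
  by_cases h : s ∈ respecting N r <;> by_cases h' : s ∈ respecting N r' <;> simp [h0, h, h']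

theorem mul_mem_atomSpan [Fintype ι] [DecidableEq ι] {I I' : Finset ι} (hI : Disjoint I I')
    {Q Q' R : (ι × Bool → ι × Bool → Prop) → Prop} (hQ : ∀ r r', Q r → Q' r' → R (r ⊔ r'))
    {F G : (N : ℕ) → (ι × Bool → Fin (N + 1)) → ℂ} (hF : F ∈ atomSpan I Q)
    (hG : G ∈ atomSpan I' Q') : F * G ∈ atomSpan (I ∪ I') R := by
  have := Submodule.mul_mem_mul hF hG
  rw [atomSpan, atomSpan, Submodule.span_mul_span] at this
  refine Submodule.span_le.2 ?_ this
  rintro _ ⟨_, ⟨r, b, h, hq, rfl⟩, _, ⟨r', b', h', hq', rfl⟩, rfl⟩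
  show atom r b * atom r' b' ∈ atomSpan (I ∪ I') R
  rw [atom_mul]
  exact atom_mem_atomSpan (h.mul hI h') (hQ r r' hq hq')

theorem relIndex_mul_card_of_le {G : Type*} [AddGroup G] {A E : AddSubgroup G} (h : A ≤ E) :
    A.relIndex E * Nat.card A = Nat.card E := by
  have := AddSubgroup.relIndex_mul_relIndex ⊥ A E bot_le h
  rwa [AddSubgroup.relIndex_bot_left, AddSubgroup.relIndex_bot_left, mul_comm] at this

/-- Sums of elements of `atomSpan` over the range of a homomorphism into the assignments. -/
theorem exists_norm_sum_le [Fintype ι] {Q : (ι × Bool → ι × Bool → Prop) → Prop}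
    {F : (N : ℕ) → (ι × Bool → Fin (N + 1)) → ℂ} (hF : F ∈ atomSpan Finset.univ Q)
    {Γ : ℕ → Type*} [∀ N, AddCommGroup (Γ N)] [∀ N, Fintype (Γ N)]
    (φ : (N : ℕ) → Γ N →+ (ι × Bool → Fin (N + 1))) (D : ℕ → ℝ)
    (hD : ∀ r, Q r → ∀ N, (Nat.card
      ↥((respecting N r ⊓ diagonal N Finset.univ).comap (φ N)) : ℝ) ≤ D N) :
    ∃ K : ℝ, ∀ N, ‖∑ i, F N (φ N i)‖ ≤ K * D N := by
  classical
  induction hF using Submodule.span_induction with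
  | zero => exact ⟨0, fun N => by simp⟩
  | add F G _ _ ihF ihG =>
    obtain ⟨K, hK⟩ := ihF
    obtain ⟨K', hK'⟩ := ihG
    refine ⟨K + K', fun N => ?_⟩
    simp only [Pi.add_apply, Finset.sum_add_distrib, add_mul]
    exact (norm_add_le _ _).trans (add_le_add (hK N) (hK' N))
  | smul c F _ ih =>
    obtain ⟨K, hK⟩ := ih
    refine ⟨‖c‖ * K, fun N => ?_⟩
    simp only [Pi.smul_apply, ← Finset.smul_sum, norm_smul, mul_assoc]
    exact mul_le_mul_of_nonneg_left (hK N) (norm_nonneg _)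
  | mem F hF =>
    obtain ⟨r, b, ⟨-, K, hK⟩, hQ, rfl⟩ := hF
    refine ⟨K, fun N => ?_⟩
    set E := respecting N r with hE
    set A := E ⊓ diagonal N Finset.univ with hA
    have hK := hK N
    rw [← hE, ← hA] at hK
    have hAE : A ≤ E := inf_le_left
    have c1 : A.relIndex E * Nat.card A = Nat.card E := relIndex_mul_card_of_le hAE
    have hA' : A.comap (φ N) ≤ E.comap (φ N) := AddSubgroup.comap_mono hAE
    have c2 : (A.comap (φ N)).relIndex (E.comap (φ N)) * Nat.card ↥(A.comap (φ N))
        = Nat.card ↥(E.comap (φ N)) := relIndex_mul_card_of_le hA'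
    -- The heart of the estimate: φ⁻¹(E)/φ⁻¹(A) embeds into E/A. Thus ‖b‖ |φ⁻¹(E)| ≤ ‖b‖ [E : A]
    -- |φ⁻¹(A)|, where ‖b‖ [E : A] ≤ K by the bound for atoms.
    have c3 : (A.comap (φ N)).relIndex (E.comap (φ N)) ≤ A.relIndex E := by
      rw [AddSubgroup.relIndex_comap]
      refine AddSubgroup.relIndex_le_of_le_right (AddSubgroup.map_comap_le _ _) ?_
      exact (AddSubgroup.instFiniteIndex_addSubgroupOf A E).index_ne_zero
    have hApos : (0 : ℝ) < Nat.card A := Nat.cast_pos.2 Nat.card_pos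
    have hbK : ‖b N‖ * A.relIndex E ≤ K := by
      refine le_of_mul_le_mul_right ?_ hApos
      rw [mul_assoc, ← Nat.cast_mul, c1]
      exact hK
    have hK0 : 0 ≤ K := le_trans (by positivity) hbK
    have hsum : ∑ i, atom r b N (φ N i) = (Nat.card ↥(E.comap (φ N)) : ℂ) * b N := by
      have : ∀ i, atom r b N (φ N i) = if i ∈ E.comap (φ N) then b N else 0 := fun i => rfl
      simp only [this]
      rw [Finset.sum_ite, Finset.sum_const, Finset.sum_const_zero, add_zero, nsmul_eq_mul,
        Nat.card_eq_fintype_card, Fintype.card_subtype]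
    rw [hsum, norm_mul, Complex.norm_natCast, ← c2]
    calc (((A.comap (φ N)).relIndex (E.comap (φ N)) * Nat.card ↥(A.comap (φ N)) : ℕ) : ℝ) * ‖b N‖
        ≤ ((A.relIndex E * Nat.card ↥(A.comap (φ N)) : ℕ) : ℝ) * ‖b N‖ := by gcongr
      _ = (‖b N‖ * A.relIndex E) * Nat.card ↥(A.comap (φ N)) := by push_cast; ring
      _ ≤ K * Nat.card ↥(A.comap (φ N)) := by gcongr
      _ ≤ K * D N := mul_le_mul_of_nonneg_left (hD r hQ N) hK0

end IndexAssignments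

/-! ### Premaps as identifications of indices -/

section Pairings

variable {ι : Type*}

/-- The integer, an element of `±I`, that labels the index `x`; the sign `ε` tells whether the
matrix at the position `x.1` is transposed. -/
def indexLabel (e : ι ↪ ℤ) (ε : ι → ℤˣ) (x : ι × Bool) : ℤ :=
  (if x.2 then 1 else -1) * ((ε x.1 : ℤ) * e x.1)

theorem indexLabel_not (e : ι ↪ ℤ) (ε : ι → ℤˣ) (x : ι × Bool) :
    indexLabel e ε (x.1, !x.2) = -indexLabel e ε x := by
  unfold indexLabel
  cases x.2 <;> simp

theorem indexLabel_eq_or (e : ι ↪ ℤ) (ε : ι → ℤˣ) (x : ι × Bool) :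
    indexLabel e ε x = e x.1 ∨ indexLabel e ε x = -e x.1 := by
  unfold indexLabel
  rcases Int.units_eq_one_or (ε x.1) with h | h <;> cases x.2 <;> simp [h]

theorem indexLabel_injective {e : ι ↪ ℤ} (he : ∀ k, 0 < e k) (ε : ι → ℤˣ) :
    Function.Injective (indexLabel e ε) := by
  intro x y hxy
  have h1 : x.1 = y.1 := by
    apply e.injective
    have := he x.1
    have := he y.1
    rcases indexLabel_eq_or e ε x with h | h <;> rcases indexLabel_eq_or e ε y with h' | h' <;>
      rw [h, h'] at hxy <;> omega
  refine Prod.ext h1 ?_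
  obtain ⟨k, b⟩ := x
  obtain ⟨k', b'⟩ := y
  obtain rfl : k = k' := h1
  have hn : indexLabel e ε (k, !b') = -indexLabel e ε (k, b') := indexLabel_not e ε (k, b')
  have hp := he k
  by_cases hb : b = b'
  · exact hb
  · have hb' : b = !b' := by revert hb; cases b <;> cases b' <;> decide
    rw [hb', hn] at hxy
    rcases indexLabel_eq_or e ε (k, b') with h | h <;> rw [h] at hxy <;> simp only at hxy <;> omega

theorem mem_signedSet_map {e : ι ↪ ℤ} {ε : ι → ℤˣ} {I : Finset ι} {z : ℤ} :
    z ∈ signedSet (I.map e) ↔ ∃ x : ι × Bool, x.1 ∈ I ∧ indexLabel e ε x = z := by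
  rw [mem_signedSet, Finset.mem_map, Finset.mem_map]
  constructor
  · rintro (⟨k, hk, rfl⟩ | ⟨k, hk, hz⟩)
    · rcases indexLabel_eq_or e ε (k, true) with h | h
      · exact ⟨(k, true), hk, h⟩
      · refine ⟨(k, false), hk, ?_⟩
        rw [← neg_inj, ← h]; exact (indexLabel_not e ε (k, false)).symm
    · rw [eq_neg_of_add_eq_zero_left (a := z) (b := e k) (by rw [hz]; ring)]
      rcases indexLabel_eq_or e ε (k, true) with h | h
      · refine ⟨(k, false), hk, ?_⟩
        rw [← h, ← indexLabel_not]; rfl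
      · exact ⟨(k, true), hk, h⟩
  · rintro ⟨x, hx, rfl⟩
    rcases indexLabel_eq_or e ε x with h | h <;> rw [h]
    · exact Or.inl ⟨x.1, hx, rfl⟩
    · exact Or.inr ⟨x.1, hx, by simp⟩

theorem indexLabel_mem {e : ι ↪ ℤ} (he : ∀ k, 0 < e k) {ε : ι → ℤˣ} {I : Finset ι}
    {x : ι × Bool} : indexLabel e ε x ∈ signedSet (I.map e) ↔ x.1 ∈ I := by
  rw [mem_signedSet_map (ε := ε)]
  refine ⟨?_, fun h => ⟨x, h, rfl⟩⟩
  rintro ⟨y, hy, hxy⟩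
  rw [← indexLabel_injective he ε hxy]
  exact hy

theorem pos_of_mem_map {e : ι ↪ ℤ} (he : ∀ k, 0 < e k) (I : Finset ι) : ∀ k ∈ I.map e, 0 < k := by
  intro k hk
  obtain ⟨j, -, rfl⟩ := Finset.mem_map.1 hk
  exact he j

/-- The identifications of the indices at the positions `I` that belong to the premap `π`. -/
def premapRel (e : ι ↪ ℤ) (ε : ι → ℤˣ) (I : Finset ι) (π : Perm ℤ) (x y : ι × Bool) : Prop :=
  x.1 ∈ I ∧ y.1 ∈ I ∧ indexLabel e ε y = π (-indexLabel e ε x)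

theorem exists_premapRel {e : ι ↪ ℤ} {ε : ι → ℤˣ} {I : Finset ι} {π : Perm ℤ}
    (hπ : IsPremap (I.map e) π) {x : ι × Bool} (hx : x.1 ∈ I) :
    ∃ y, premapRel e ε I π x y := by
  have h : π (-indexLabel e ε x) ∈ signedSet (I.map e) := by
    rw [hπ.1.apply_mem, neg_mem_signedSet]
    exact mem_signedSet_map.2 ⟨x, hx, rfl⟩
  obtain ⟨y, hy, hyx⟩ := mem_signedSet_map.1 h
  exact ⟨y, hx, hy, hyx⟩

theorem premapRel_symm {e : ι ↪ ℤ} {ε : ι → ℤˣ} {I : Finset ι} {π : Perm ℤ}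
    (hπ : IsPremap (I.map e) π) {x y : ι × Bool} (h : premapRel e ε I π x y) :
    premapRel e ε I π y x := by
  refine ⟨h.2.1, h.1, ?_⟩
  rw [h.2.2, hπ.apply_neg_apply, neg_neg]

theorem premapRel_ne {e : ι ↪ ℤ} {ε : ι → ℤˣ} {I : Finset ι} {π : Perm ℤ}
    (hπ : IsPremap (I.map e) π) {x y : ι × Bool} (h : premapRel e ε I π x y) : x ≠ y := by
  rintro rfl
  have h1 := (hπ.2 (indexLabel e ε x) (mem_signedSet_map.2 ⟨x, h.1, rfl⟩)).2
  refine h1 (Perm.SameCycle.symm ⟨1, ?_⟩)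
  rw [zpow_one]; exact h.2.2.symm

/-- The fixed-point-free involution `z ↦ π (-z)` exchanges the smaller and the larger members of the
matched pairs, and ±I has 2|I| elements. -/
theorem IsPremap.card_filter_lt {I : Finset ℤ} (hI : ∀ k ∈ I, 0 < k) {π : Perm ℤ}
    (h : IsPremap I π) : ((signedSet I).filter (fun z => z < π (-z))).card = I.card := by
  have h1 : ((signedSet I).filter (fun z => z < π (-z))).card
      = ((signedSet I).filter (fun z => ¬ z < π (-z))).card := by
    refine Finset.card_bij' (fun z _ => π (-z)) (fun z _ => π (-z)) ?_ ?_ ?_ ?_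
    · intro z hz
      rw [Finset.mem_filter] at hz ⊢
      rw [h.1.apply_mem, neg_mem_signedSet, h.apply_neg_apply, neg_neg]
      exact ⟨hz.1, hz.2.not_gt⟩
    · intro z hz
      rw [Finset.mem_filter] at hz ⊢
      rw [h.1.apply_mem, neg_mem_signedSet, h.apply_neg_apply, neg_neg]
      refine ⟨hz.1, lt_of_le_of_ne (not_lt.1 hz.2) fun hne => ?_⟩
      exact (h.2 z hz.1).2 (Perm.SameCycle.symm ⟨1, by rw [zpow_one, hne]⟩)
    · intro z _
      rw [h.apply_neg_apply, neg_neg]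
    · intro z _
      rw [h.apply_neg_apply, neg_neg]
  have h2 : (signedSet I).card = I.card + I.card := by
    unfold signedSet
    rw [Finset.card_union_of_disjoint, Finset.card_image_of_injective _ neg_injective]
    rw [Finset.disjoint_left]
    intro a ha hb
    obtain ⟨b, hb', rfl⟩ := Finset.mem_image.1 hb
    have h1 := hI _ ha
    have h2 := hI _ hb'
    omega
  have h3 := Finset.card_filter_add_card_filter_not (s := signedSet I) (fun z => z < π (-z))
  omega

/-- On the positions `I`, a respecting assignment has at most one free value for each of the |I|
matched pairs, whereas a diagonal one can be prescribed on each pair of mirror cycles; off `I` both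
are free. The inequality comes from an injection that stores `s` on one index of each matched pair,
and keeps the cycle values `t` together with `s` off `I` in a diagonal assignment. -/
theorem card_respecting_premapRel_le [Fintype ι] {e : ι ↪ ℤ} (he : ∀ k, 0 < e k) (ε : ι → ℤˣ)
    (I : Finset ι) {π : Perm ℤ} (hπ : IsPremap (I.map e) π) (N : ℕ) :
    (N + 1) ^ (particular (I.map e) π).card * Nat.card (respecting N (premapRel e ε I π))
      ≤ (N + 1) ^ I.card
        * Nat.card ↥(respecting N (premapRel e ε I π) ⊓ diagonal N I) := by
  classical
  have hI := pos_of_mem_map he I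
  set R := particular (I.map e) π with hR
  set h := indexLabel e ε with hh
  -- One label, the smaller one, from each matched pair.
  set G := (signedSet (I.map e)).filter (fun z => z < π (-z)) with hG
  have hrep : ∀ x : ι × Bool, x.1 ∈ I → ∃ k : R, SameCyclePair π (h x) k := by
    intro x hx
    obtain ⟨k, hk, hs⟩ := hπ.exists_particular hI (mem_signedSet_map.2 ⟨x, hx, rfl⟩)
    exact ⟨⟨k, hk⟩, hs⟩
  have hcongr : ∀ k k' : ℤ, ∀ x y, (∀ j, SameCyclePair π (h x) j ↔ SameCyclePair π (h y) j) →
      k ∈ R → k' ∈ R → SameCyclePair π (h x) k → SameCyclePair π (h y) k' → k = k' := by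
    intro k k' x y hxy hk hk' hs hs'
    rw [← hxy] at hs'
    refine hπ.particular_unique hI hk hk' ?_
    rcases hs with hs | hs
    · exact (hπ.sameCyclePair_congr hs).1 hs'
    · exact (hπ.sameCyclePair_congr hs).1 (SameCyclePair.neg.2 hs')
  have hcard1 : Nat.card (R → Fin (N + 1)) = (N + 1) ^ R.card := by simp
  have hcard2 : Nat.card (G → Fin (N + 1)) = (N + 1) ^ I.card := by
    rw [Nat.card_fun, Nat.card_fin, Nat.card_eq_fintype_card, Fintype.card_coe,
      hπ.card_filter_lt hI, Finset.card_map]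
  rw [← hcard1, ← hcard2, ← Nat.card_prod, ← Nat.card_prod]
  choose rep hrep using hrep
  have hrel : ∀ x y (hx : x.1 ∈ I) (hy : y.1 ∈ I), (∀ j, SameCyclePair π (h x) j ↔
      SameCyclePair π (h y) j) → rep x hx = rep y hy := fun x y hx hy hxy =>
    Subtype.ext (hcongr _ _ x y hxy (rep x hx).2 (rep y hy).2 (hrep x hx) (hrep y hy))
  let g : (R → Fin (N + 1)) → (ι × Bool → Fin (N + 1)) → ι × Bool → Fin (N + 1) :=
    fun t s x => if hx : x.1 ∈ I then t (rep x hx) else s x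
  have hg : ∀ t s, g t s ∈ respecting N (premapRel e ε I π) ⊓ diagonal N I := by
    intro t s
    refine AddSubgroup.mem_inf.2 ⟨fun x y hxy => ?_, mem_diagonal.2 fun k hk => ?_⟩
    · have hx := hxy.1
      have hy := hxy.2.1
      simp only [g, hx, hy, dif_pos]
      congr 1
      refine hrel x y hx hy fun j => ?_
      rw [← SameCyclePair.neg]
      exact hπ.sameCyclePair_congr ⟨1, by rw [zpow_one]; exact hxy.2.2.symm⟩
    · simp only [g, hk, dif_pos]
      congr 1
      refine hrel _ _ hk hk fun j => ?_
      rw [← SameCyclePair.neg, ← indexLabel_not]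
      rfl
  have hz : ∀ z : G, ∃ x : ι × Bool, x.1 ∈ I ∧ h x = z := fun z =>
    mem_signedSet_map.1 (Finset.mem_filter.1 z.2).1
  choose lab _ hlab2 using hz
  refine Nat.card_le_card_of_injective
    (fun p : (R → Fin (N + 1)) × respecting N (premapRel e ε I π) =>
      ((fun z => p.2.1 (lab z), ⟨g p.1 p.2.1, hg _ _⟩) :
        (G → Fin (N + 1)) × ↥(respecting N (premapRel e ε I π) ⊓ diagonal N I))) ?_
  rintro ⟨t, s, hs⟩ ⟨t', s', hs'⟩ heq
  have heq1 : ∀ z, s (lab z) = s' (lab z) := fun z => congrFun (congrArg Prod.fst heq) z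
  have heq2 : ∀ x, g t s x = g t' s' x := fun x =>
    congrFun (congrArg Subtype.val (congrArg Prod.snd heq)) x
  have ht : t = t' := by
    funext k
    obtain ⟨j, hj, hjk⟩ := Finset.mem_map.1 (mem_particular.1 k.2).1
    have h1 := heq2 (j, true)
    simp only [g, hj, dif_pos] at h1
    have h2 : rep (j, true) hj = k := by
      refine Subtype.ext (hcongr _ _ (j, true) (j, true) (fun _ => Iff.rfl)
        (rep (j, true) hj).2 k.2 (hrep _ _) ?_)
      rcases indexLabel_eq_or e ε (j, true) with h3 | h3
      · rw [hh, h3, hjk]; exact Or.inl (Perm.SameCycle.refl _ _)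
      · rw [hh, h3, hjk]; exact Or.inr (by rw [neg_neg])
    rwa [h2] at h1
  have hlab : ∀ x : ι × Bool, h x ∈ G → s x = s' x := by
    intro x hx
    have : lab ⟨h x, hx⟩ = x := indexLabel_injective he ε (hlab2 ⟨h x, hx⟩)
    rw [← this]; exact heq1 _
  have hss : s = s' := by
    funext x
    by_cases hx : x.1 ∈ I
    · have hmem : h x ∈ signedSet (I.map e) := mem_signedSet_map.2 ⟨x, hx, rfl⟩
      by_cases hxG : h x < π (-h x)
      · exact hlab x (Finset.mem_filter.2 ⟨hmem, hxG⟩)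
      -- The label of `x` is the larger one of its pair, so its partner `y` belongs to `G`, and `s`
      -- takes the same value there.
      · obtain ⟨y, hy⟩ := exists_premapRel (ε := ε) hπ hx
        rw [hs x y hy, hs' x y hy]
        refine hlab y (Finset.mem_filter.2 ⟨mem_signedSet_map.2 ⟨y, hy.2.1, rfl⟩, ?_⟩)
        have h2 := (premapRel_symm hπ hy).2.2
        rw [← hh] at h2
        rw [← h2, hh, hy.2.2, ← hh]
        refine lt_of_le_of_ne (not_lt.1 hxG) fun hne => ?_
        exact premapRel_ne hπ hy (indexLabel_injective he ε (by rw [hy.2.2, ← hh, hne]))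
    · have := heq2 x
      simpa only [g, hx, dif_neg, not_false_eq_true] using this
  subst ht hss
  rfl

end Pairings

/-! ### The entries of a single ensemble -/

section SingleEnsemble

variable {ι : Type*}

/-- `r` relates an index at a position of `J` to an index at another position. -/
def Links (J : Finset ι) (r : ι × Bool → ι × Bool → Prop) : Prop :=
  ∃ x y, r x y ∧ x.1 ∈ J ∧ y.1 ∉ J

/-- Infinitesimal invariance under rotations that act on the indices at the positions `I`. -/
def RotationInvariant [DecidableEq ι] {M : ℕ} (I : Finset ι) (F : (ι × Bool → Fin M) → ℂ) : Prop :=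
  ∀ A : Matrix (Fin M) (Fin M) ℂ, A.transpose = -A → ∀ s : ι × Bool → Fin M,
    ∑ x ∈ I ×ˢ Finset.univ, ∑ j, A (s x) j * F (Function.update s x j) = 0

theorem RotationInvariant.sum [DecidableEq ι] {M : ℕ} {I : Finset ι} {α : Type*} (S : Finset α)
    (F : α → (ι × Bool → Fin M) → ℂ) (h : ∀ a ∈ S, RotationInvariant I (F a)) :
    RotationInvariant I (∑ a ∈ S, F a) := by
  intro A hA s
  simp only [Finset.sum_apply, Finset.mul_sum]
  have h1 : ∑ x ∈ I ×ˢ Finset.univ, ∑ j, ∑ a ∈ S, A (s x) j * F a (Function.update s x j)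
      = ∑ a ∈ S, ∑ x ∈ I ×ˢ Finset.univ, ∑ j, A (s x) j * F a (Function.update s x j) :=
    (Finset.sum_congr rfl fun x _ => Finset.sum_comm).trans Finset.sum_comm
  rw [h1]
  exact Finset.sum_eq_zero fun a ha => h a ha A hA s

/-- Moving one end of a matched pair replaces δ(s x, s y) by A(s x, s y), moving the other end
replaces it by A(s y, s x), and antisymmetry cancels the two. The matching is thus the
sign-reversing involution on the sum. -/
theorem atom_premapRel_rotationInvariant [DecidableEq ι] {e : ι ↪ ℤ} (he : ∀ k, 0 < e k)
    (ε : ι → ℤˣ) (I : Finset ι) {π : Perm ℤ} (hπ : IsPremap (I.map e) π) (b : ℕ → ℂ) (N : ℕ) :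
    RotationInvariant I (atom (premapRel e ε I π) b N) := by
  classical
  intro A hA s
  have hex : ∀ x : ι × Bool, x ∈ I ×ˢ (Finset.univ : Finset Bool) →
      ∃ y, premapRel e ε I π x y := fun x hx =>
    exists_premapRel hπ (Finset.mem_product.1 hx).1
  choose τ hτ using hex
  have huniq : ∀ {x y y'}, premapRel e ε I π x y → premapRel e ε I π x y' → y = y' :=
    fun h h' => indexLabel_injective he ε (h.2.2.trans h'.2.2.symm)
  have key : ∀ x y, premapRel e ε I π x y →
      ∑ j, A (s x) j * atom (premapRel e ε I π) b N (Function.update s x j)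
        = A (s x) (s y) * if ∀ u v, premapRel e ε I π u v → u ≠ x → u ≠ y → s u = s v
            then b N else 0 := by
    intro x y hxy
    have hne := premapRel_ne hπ hxy
    have hiff : ∀ j, Function.update s x j ∈ respecting N (premapRel e ε I π) ↔
        j = s y ∧ ∀ u v, premapRel e ε I π u v → u ≠ x → u ≠ y → s u = s v := by
      intro j
      constructor
      · intro h
        refine ⟨?_, fun u v huv hux huy => ?_⟩
        · have := h x y hxy
          rwa [Function.update_self, Function.update_of_ne hne.symm] at this
        · have := h u v huv
          rwa [Function.update_of_ne hux, Function.update_of_ne] at this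
          rintro rfl
          exact huy (huniq (premapRel_symm hπ huv) hxy)
      · rintro ⟨rfl, h⟩ u v huv
        by_cases hux : u = x
        · subst hux
          rw [huniq huv hxy, Function.update_self, Function.update_of_ne hne.symm]
        · by_cases huy : u = y
          · subst huy
            rw [huniq huv (premapRel_symm hπ hxy), Function.update_self,
              Function.update_of_ne hne.symm]
          · rw [Function.update_of_ne hux, Function.update_of_ne]
            · exact h u v huv hux huy
            · rintro rfl
              exact huy (huniq (premapRel_symm hπ huv) hxy)
    simp only [atom, hiff]
    rw [Finset.sum_eq_single (s y)]
    · simp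
    · intro j _ hj; simp [hj]
    · simp
  refine Finset.sum_involution τ (fun x hx => ?_) (fun x hx _ => ?_) (fun x hx => ?_)
    (fun x hx => ?_)
  · rw [key x _ (hτ x hx), key _ x (premapRel_symm hπ (hτ x hx))]
    have h1 : A (s (τ x hx)) (s x) = -A (s x) (s (τ x hx)) :=
      congrFun (congrFun hA (s x)) (s (τ x hx))
    rw [h1, neg_mul, add_neg_eq_zero]
    congr 1
    exact if_congr ⟨fun h u v huv h1 h2 => h u v huv h2 h1, fun h u v huv h1 h2 => h u v huv h2 h1⟩
      rfl rfl
  · exact (premapRel_ne hπ (hτ x hx)).symm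
  · exact Finset.mem_product.2 ⟨(hτ x hx).2.1, Finset.mem_univ _⟩
  · exact huniq (hτ _ _) (premapRel_symm hπ (hτ x hx))

variable {Ω Λ : Type*} [MeasurableSpace Ω]

/-- The mixed moments of the entries, at the positions `I`, of matrices from an ensemble. -/
noncomputable def entryMoment (P : Measure Ω) (X : (N : ℕ) → Λ → Ω → Matrix (Fin N) (Fin N) ℂ)
    (l : ℤ → Λ) (e : ι ↪ ℤ) (ε : ι → ℤˣ) (I : Finset ι) (N : ℕ)
    (s : ι × Bool → Fin (N + 1)) : ℂ :=
  ∫ ω, ∏ k ∈ I, signedMatrix (ε k) (X (N + 1) (l (e k)) ω) (s (k, false)) (s (k, true)) ∂P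

/-- The coefficient of the premap `π` in the expansion of `entryMoment`. -/
noncomputable def premapCoeff (f : ℕ → (ℤ → Λ) → Finset ℤ → Perm ℤ → ℂ) (l : ℤ → Λ)
    (I : Finset ℤ) (π : Perm ℤ) (N : ℕ) : ℂ :=
  ((N + 1 : ℕ) : ℂ) ^ (((particular I π).card : ℤ) - I.card) * f (N + 1) l I π

variable {P : Measure Ω}
  {X : (N : ℕ) → Λ → Ω → Matrix (Fin N) (Fin N) ℂ} {PM : Finset ℤ → Finset (Perm ℤ)}
  {f : ℕ → (ℤ → Λ) → Finset ℤ → Perm ℤ → ℂ}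

/-- Transposing the matrix at a position exchanges its two index labels. The signs are therefore
absorbed by `indexLabel`, and the moment formula without transposes suffices. -/
theorem HasPremapExpansion.entryMoment_eq [IsProbabilityMeasure P] (hX : HasPremapExpansion P X PM f) (l : ℤ → Λ)
    {e : ι ↪ ℤ} (he : ∀ k, 0 < e k) (ε : ι → ℤˣ) (I : Finset ι) :
    entryMoment P X l e ε I
      = ∑ π ∈ PM (I.map e), atom (premapRel e ε I π) (premapCoeff f l (I.map e) π) := by
  classical
  funext N s
  have hI := pos_of_mem_map he I
  have hinj := indexLabel_injective he ε
  -- The value 0 off the range of the labels is arbitrary: only labels from ± `I.map e` occur.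
  set s' : ℤ → Fin (N + 1) := Function.extend (indexLabel e ε) s (fun _ => 0) with hs'
  have hs : ∀ x, s' (indexLabel e ε x) = s x := fun x => hinj.extend_apply _ _ _
  have h1 : entryMoment P X l e ε I N s
      = ∫ ω, ∏ k ∈ I.map e, X (N + 1) (l k) ω (s' (-k)) (s' k) ∂P := by
    unfold entryMoment
    congr 1
    funext ω
    rw [Finset.prod_map]
    refine Finset.prod_congr rfl fun k _ => ?_
    rcases Int.units_eq_one_or (ε k) with h | h
    · have ht : indexLabel e ε (k, true) = e k := by simp [indexLabel, h]
      have hf : indexLabel e ε (k, false) = -e k := by simp [indexLabel, h]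
      rw [← hs (k, true), ← hs (k, false), ht, hf, h]
      simp [signedMatrix]
    · have ht : indexLabel e ε (k, true) = -e k := by simp [indexLabel, h]
      have hf : indexLabel e ε (k, false) = e k := by simp [indexLabel, h]
      rw [← hs (k, true), ← hs (k, false), ht, hf, h]
      simp [signedMatrix]
  rw [h1, hX.integral_prod_entries N.succ_pos hI, Finset.sum_apply, Finset.sum_apply]
  refine Finset.sum_congr rfl fun π hπ => ?_
  have hp := hX.isPremap _ hI π hπ
  unfold atom premapCoeff
  rw [mul_ite, mul_one, mul_zero]
  refine if_congr ⟨fun H x y hxy => ?_, fun H a ha => ?_⟩ rfl rfl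
  · have := H (-indexLabel e ε x)
      (neg_mem_signedSet.2 (mem_signedSet_map.2 ⟨x, hxy.1, rfl⟩))
    rw [← hxy.2.2, neg_neg, hs, hs] at this
    exact this.symm
  · obtain ⟨x, hx, hxa⟩ := mem_signedSet_map.1 (neg_mem_signedSet.2 ha)
    obtain ⟨y, hy⟩ := exists_premapRel (ε := ε) hp hx
    rw [← hxa, hs, H x y hy, ← hs y, hy.2.2, hxa, neg_neg]

/-- The power of N in the coefficient is exactly what the cardinality bound compensates. Of the
convergence of `f` only boundedness in N is used. -/
theorem HasPremapExpansion.isAtom [Fintype ι] (hX : HasPremapExpansion P X PM f) (l : ℤ → Λ)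
    {e : ι ↪ ℤ} (he : ∀ k, 0 < e k) (ε : ι → ℤˣ) (I : Finset ι) {π : Perm ℤ}
    (hπ : π ∈ PM (I.map e)) :
    IsAtom I (premapRel e ε I π) (premapCoeff f l (I.map e) π) := by
  have hI := pos_of_mem_map he I
  refine ⟨fun x y h => ⟨h.1, h.2.1⟩, ?_⟩
  obtain ⟨L, hL⟩ := hX.tendsto _ hI l π hπ
  obtain ⟨K, hK⟩ := (Metric.isBounded_range_of_tendsto _ hL).exists_norm_le
  refine ⟨K, fun N => ?_⟩
  have hc := card_respecting_premapRel_le he ε I (hX.isPremap _ hI π hπ) N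
  have hf : ‖f (N + 1) l (I.map e) π‖ ≤ K := hK _ ⟨N + 1, rfl⟩
  have hM : (0 : ℝ) < N + 1 := by positivity
  have hc' : ((N : ℝ) + 1) ^ (particular (I.map e) π).card
      * Nat.card (respecting N (premapRel e ε I π)) ≤ ((N : ℝ) + 1) ^ I.card
        * Nat.card ↥(respecting N (premapRel e ε I π) ⊓ diagonal N I) := by
    exact_mod_cast hc
  have hn : ‖premapCoeff f l (I.map e) π N‖ = ((N : ℝ) + 1) ^ (particular (I.map e) π).card
      / ((N : ℝ) + 1) ^ I.card * ‖f (N + 1) l (I.map e) π‖ := by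
    unfold premapCoeff
    rw [norm_mul, norm_zpow, Complex.norm_natCast, zpow_sub₀ (by positivity), Finset.card_map]
    simp
  rw [hn]
  calc _ = ‖f (N + 1) l (I.map e) π‖ * (((N : ℝ) + 1) ^ (particular (I.map e) π).card
        * Nat.card (respecting N (premapRel e ε I π)) / ((N : ℝ) + 1) ^ I.card) := by ring
    _ ≤ ‖f (N + 1) l (I.map e) π‖
        * Nat.card ↥(respecting N (premapRel e ε I π) ⊓ diagonal N I) := by
      refine mul_le_mul_of_nonneg_left ?_ (norm_nonneg _)
      rw [div_le_iff₀' (by positivity)]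
      exact hc'
    _ ≤ _ := mul_le_mul_of_nonneg_right hf (Nat.cast_nonneg _)

theorem HasPremapExpansion.entryMoment_mem [IsProbabilityMeasure P] [Fintype ι] (hX : HasPremapExpansion P X PM f)
    (l : ℤ → Λ) {e : ι ↪ ℤ} (he : ∀ k, 0 < e k) (ε : ι → ℤˣ) (I : Finset ι) :
    entryMoment P X l e ε I ∈ atomSpan I (fun _ => True) := by
  rw [hX.entryMoment_eq l he]
  exact Submodule.sum_mem _ fun π hπ => atom_mem_atomSpan (hX.isAtom l he ε I hπ) trivial

theorem HasPremapExpansion.entryMoment_rotationInvariant [IsProbabilityMeasure P] [DecidableEq ι]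
    (hX : HasPremapExpansion P X PM f)
    (l : ℤ → Λ) {e : ι ↪ ℤ} (he : ∀ k, 0 < e k) (ε : ι → ℤˣ) (I : Finset ι) (N : ℕ) :
    RotationInvariant I (entryMoment P X l e ε I N) := by
  rw [hX.entryMoment_eq l he, Finset.sum_apply]
  exact RotationInvariant.sum _ _ fun π hπ =>
    atom_premapRel_rotationInvariant he ε I (hX.isPremap _ (pos_of_mem_map he I) π hπ) _ N

/-! ### Factorization -/

section Product

variable {I J : Finset ℤ} {π₁ π₂ : Perm ℤ}

theorem signedSet_disjoint_sdiff (hI : ∀ k ∈ I, 0 < k) (hJ : J ⊆ I) {a : ℤ}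
    (ha : a ∈ signedSet J) : a ∉ signedSet (I \ J) := by
  intro hb
  rw [mem_signedSet, Finset.mem_sdiff, Finset.mem_sdiff] at hb
  rcases mem_signedSet.1 ha with h | h <;> have h1 := hI _ (hJ h) <;>
    rcases hb with hb | hb
  · exact hb.2 h
  · have := hI _ hb.1; omega
  · have := hI _ hb.1; omega
  · exact hb.2 h

theorem IsPermOn.mul_apply_left (hI : ∀ k ∈ I, 0 < k) (hJ : J ⊆ I)
    (h₂ : IsPermOn (signedSet (I \ J)) π₂) {a : ℤ} (ha : a ∈ signedSet J) :
    (π₁ * π₂) a = π₁ a := by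
  rw [Perm.mul_apply, h₂ a (signedSet_disjoint_sdiff hI hJ ha)]

theorem IsPermOn.mul_apply_right (hI : ∀ k ∈ I, 0 < k) (hJ : J ⊆ I)
    (h₁ : IsPermOn (signedSet J) π₁) (h₂ : IsPermOn (signedSet (I \ J)) π₂) {a : ℤ}
    (ha : a ∉ signedSet J) : (π₁ * π₂) a = π₂ a := by
  rw [Perm.mul_apply]
  refine h₁ _ fun h => ?_
  by_cases ha' : a ∈ signedSet (I \ J)
  · exact signedSet_disjoint_sdiff hI hJ h (h₂.apply_mem.2 ha')
  · rw [h₂ a ha'] at h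
    exact ha h

theorem IsPermOn.commute (hI : ∀ k ∈ I, 0 < k) (hJ : J ⊆ I)
    (h₁ : IsPermOn (signedSet J) π₁) (h₂ : IsPermOn (signedSet (I \ J)) π₂) :
    Commute π₁ π₂ := by
  ext a
  by_cases ha : a ∈ signedSet J
  · rw [h₂.mul_apply_left hI hJ ha, Perm.mul_apply]
    exact (h₂ _ (signedSet_disjoint_sdiff hI hJ (h₁.apply_mem.2 ha))).symm
  · rw [h₁.mul_apply_right hI hJ h₂ ha, Perm.mul_apply, h₁ a ha]

theorem IsPermOn.sameCycle_mul_left (hI : ∀ k ∈ I, 0 < k) (hJ : J ⊆ I)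
    (h₁ : IsPermOn (signedSet J) π₁) (h₂ : IsPermOn (signedSet (I \ J)) π₂) {a b : ℤ}
    (ha : a ∈ signedSet J) : (π₁ * π₂).SameCycle a b ↔ π₁.SameCycle a b := by
  refine exists_congr fun i => ?_
  rw [(h₁.commute hI hJ h₂).mul_zpow, Perm.mul_apply, Perm.zpow_apply_eq_self_of_apply_eq_self
    (h₂ a (signedSet_disjoint_sdiff hI hJ ha))]

theorem IsPermOn.sameCycle_mul_right (hI : ∀ k ∈ I, 0 < k) (hJ : J ⊆ I)
    (h₁ : IsPermOn (signedSet J) π₁) (h₂ : IsPermOn (signedSet (I \ J)) π₂) {a b : ℤ}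
    (ha : a ∉ signedSet J) : (π₁ * π₂).SameCycle a b ↔ π₂.SameCycle a b := by
  refine exists_congr fun i => ?_
  rw [(h₁.commute hI hJ h₂), (h₁.commute hI hJ h₂).symm.mul_zpow, Perm.mul_apply,
    Perm.zpow_apply_eq_self_of_apply_eq_self (h₁ a ha)]

/-- Needed so that the power of N in `premapCoeff` is multiplicative along with `f`. -/
theorem IsPermOn.particular_mul (hI : ∀ k ∈ I, 0 < k) (hJ : J ⊆ I)
    (h₁ : IsPermOn (signedSet J) π₁) (h₂ : IsPermOn (signedSet (I \ J)) π₂) :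
    (particular I (π₁ * π₂)).card = (particular J π₁).card + (particular (I \ J) π₂).card := by
  classical
  rw [← Finset.card_union_of_disjoint]
  · congr 1
    ext k
    rw [Finset.mem_union, mem_particular, mem_particular, mem_particular, Finset.mem_sdiff]
    by_cases hk : k ∈ J
    · have : k ∈ signedSet J := mem_signedSet.2 (Or.inl hk)
      simp [hk, hJ hk, h₁.sameCycle_mul_left hI hJ h₂ this]
    · by_cases hk' : k ∈ I
      · have : k ∉ signedSet J := fun h => by
          rcases mem_signedSet.1 h with h | h
          · exact hk h
          · have := hI _ (hJ h); have := hI _ hk'; omega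
        simp [hk, hk', h₁.sameCycle_mul_right hI hJ h₂ this]
      · simp [hk, hk']
  · rw [Finset.disjoint_left]
    intro k hk hk'
    exact (Finset.mem_sdiff.1 (mem_particular.1 hk').1).2 (mem_particular.1 hk).1

end Product

/-- If no matched pair left `J`, then ±J would be stable under `π`, and no cycle could reach the
other positions. -/
theorem links_premapRel {e : ι ↪ ℤ} (he : ∀ k, 0 < e k) (ε : ι → ℤˣ) {I J : Finset ι}
    (hJ : J ⊆ I) {π : Perm ℤ} (hπ : IsPremap (I.map e) π)
    (hc : Connects π (signedSet (J.map e)) (signedSet (I.map e \ J.map e))) :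
    Links J (premapRel e ε I π) := by
  by_contra hL
  obtain ⟨a, ha, b, hb, hab⟩ := hc
  have hJ' : J.map e ⊆ I.map e := Finset.map_subset_map.2 hJ
  have hstep : ∀ z ∈ signedSet (J.map e), π z ∈ signedSet (J.map e) := by
    intro z hz
    obtain ⟨x, hx, hxz⟩ := (mem_signedSet_map (ε := ε)).1 (neg_mem_signedSet.2 hz)
    obtain ⟨y, hy⟩ := exists_premapRel (ε := ε) hπ (hJ hx)
    have hyJ : y.1 ∈ J := by
      by_contra hyJ
      exact hL ⟨x, y, hy, hx, hyJ⟩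
    refine (mem_signedSet_map (ε := ε)).2 ⟨y, hyJ, ?_⟩
    rw [hy.2.2, hxz, neg_neg]
  obtain ⟨i, -, rfl⟩ := hπ.1.exists_pow_apply_eq hab
  have hpow : ∀ i : ℕ, (π ^ i) a ∈ signedSet (J.map e) := by
    intro i
    induction i with
    | zero => exact ha
    | succ i ih => rw [pow_succ', Perm.mul_apply]; exact hstep _ ih
  exact signedSet_disjoint_sdiff (pos_of_mem_map he I) hJ' (hpow i) hb

theorem HasPremapExpansion.atom_mul_atom [DecidableEq ι] (hX : HasPremapExpansion P X PM f)
    (l : ℤ → Λ) {e : ι ↪ ℤ} (he : ∀ k, 0 < e k) (ε : ι → ℤˣ) {I J : Finset ι} (hJ : J ⊆ I)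
    {π₁ π₂ : Perm ℤ} (h₁ : π₁ ∈ PM (J.map e)) (h₂ : π₂ ∈ PM (I.map e \ J.map e)) :
    atom (premapRel e ε J π₁) (premapCoeff f l (J.map e) π₁)
        * atom (premapRel e ε (I \ J) π₂) (premapCoeff f l (I.map e \ J.map e) π₂)
      = atom (premapRel e ε I (π₁ * π₂)) (premapCoeff f l (I.map e) (π₁ * π₂)) := by
  have hI := pos_of_mem_map he I
  have hJ' : J.map e ⊆ I.map e := Finset.map_subset_map.2 hJ
  have p₁ := (hX.isPremap _ (pos_of_mem_map he J) π₁ h₁).1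
  have p₂ := (hX.isPremap _ (fun k hk => hI k (Finset.sdiff_subset hk)) π₂ h₂).1
  rw [atom_mul]
  congr 1
  · funext x y
    refine propext ⟨?_, fun h => ?_⟩
    · rintro (h | h)
      · refine ⟨hJ h.1, hJ h.2.1, ?_⟩
        rw [p₂.mul_apply_left hI hJ', h.2.2]
        exact neg_mem_signedSet.2 ((indexLabel_mem he).2 h.1)
      · refine ⟨Finset.sdiff_subset h.1, Finset.sdiff_subset h.2.1, ?_⟩
        rw [p₁.mul_apply_right hI hJ' p₂, h.2.2]
        rw [neg_mem_signedSet, indexLabel_mem he]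
        exact (Finset.mem_sdiff.1 h.1).2
    · by_cases hx : x.1 ∈ J
      · have hm : -indexLabel e ε x ∈ signedSet (J.map e) :=
          neg_mem_signedSet.2 ((indexLabel_mem he).2 hx)
        have h3 := h.2.2
        rw [p₂.mul_apply_left hI hJ' hm] at h3
        refine Or.inl ⟨hx, ?_, h3⟩
        rw [← indexLabel_mem he (ε := ε), h3, p₁.apply_mem]
        exact hm
      · have hm : -indexLabel e ε x ∉ signedSet (J.map e) := by
          rwa [neg_mem_signedSet, indexLabel_mem he]
        have hm' : -indexLabel e ε x ∈ signedSet (I.map e \ J.map e) := by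
          rw [← Finset.map_sdiff, neg_mem_signedSet, indexLabel_mem he, Finset.mem_sdiff]
          exact ⟨h.1, hx⟩
        have h3 := h.2.2
        rw [p₁.mul_apply_right hI hJ' p₂ hm] at h3
        refine Or.inr ⟨Finset.mem_sdiff.2 ⟨h.1, hx⟩, ?_, h3⟩
        rw [← indexLabel_mem he (ε := ε), h3, Finset.map_sdiff, p₂.apply_mem]
        exact hm'
  · funext N
    have hM : ((N + 1 : ℕ) : ℂ) ≠ 0 := Nat.cast_ne_zero.2 N.succ_ne_zero
    have hc : (I.map e \ J.map e).card + (J.map e).card = (I.map e).card :=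
      Finset.card_sdiff_add_card_eq_card hJ'
    simp only [Pi.mul_apply, premapCoeff]
    rw [hX.multiplicative _ N.succ_pos _ hI _ hJ' l _ h₁ _ h₂,
      p₁.particular_mul hI hJ' p₂, ← hc, mul_mul_mul_comm, ← zpow_add₀ hM]
    congr 2
    push_cast
    ring

/-- The product of the two moments is the part of the expansion over the premaps that do not connect
`J` to its complement; the product condition makes this a bijection and multiplicativity matches the
coefficients. What remains are the connecting premaps. -/
theorem HasPremapExpansion.entryMoment_sub_mem [IsProbabilityMeasure P] [Fintype ι] [DecidableEq ι]
    (hX : HasPremapExpansion P X PM f)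
    (l : ℤ → Λ) {e : ι ↪ ℤ} (he : ∀ k, 0 < e k) (ε : ι → ℤˣ) {I J : Finset ι} (hJ : J ⊆ I) :
    entryMoment P X l e ε I - entryMoment P X l e ε J * entryMoment P X l e ε (I \ J)
      ∈ atomSpan I (Links J) := by
  classical
  have hI := pos_of_mem_map he I
  have hJ' : J.map e ⊆ I.map e := Finset.map_subset_map.2 hJ
  have hprod := hX.product _ hI _ hJ'
  have hsplit : entryMoment P X l e ε J * entryMoment P X l e ε (I \ J)
      = ∑ π ∈ (PM (I.map e)).filter
          (fun π => ¬ Connects π (signedSet (J.map e)) (signedSet (I.map e \ J.map e))),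
          atom (premapRel e ε I π) (premapCoeff f l (I.map e) π) := by
    rw [hX.entryMoment_eq l he, hX.entryMoment_eq l he, Finset.sum_mul_sum, ← Finset.sum_product',
      Finset.map_sdiff]
    refine Finset.sum_bij (fun p _ => p.1 * p.2) ?_ ?_ ?_ ?_
    · rintro ⟨π₁, π₂⟩ hp
      rw [Finset.mem_product] at hp
      exact Finset.mem_filter.2 ((hprod _).2 ⟨π₁, hp.1, π₂, hp.2, rfl⟩)
    · rintro ⟨π₁, π₂⟩ hp ⟨π₁', π₂'⟩ hp' heq
      rw [Finset.mem_product] at hp hp'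
      have p₁ := (hX.isPremap _ (pos_of_mem_map he J) _ hp.1).1
      have p₂ := (hX.isPremap _ (fun k hk => hI k (Finset.sdiff_subset hk)) _ hp.2).1
      have p₁' := (hX.isPremap _ (pos_of_mem_map he J) _ hp'.1).1
      have p₂' := (hX.isPremap _ (fun k hk => hI k (Finset.sdiff_subset hk)) _ hp'.2).1
      have h1 : π₁ = π₁' := by
        ext a
        by_cases ha : a ∈ signedSet (J.map e)
        · exact (p₂.mul_apply_left hI hJ' ha).symm.trans
            ((congrArg (fun q : Perm ℤ => q a) heq).trans (p₂'.mul_apply_left hI hJ' ha))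
        · rw [p₁ a ha, p₁' a ha]
      have heq' : π₁ * π₂ = π₁' * π₂' := heq
      rw [h1] at heq'
      exact Prod.ext h1 (mul_left_cancel heq')
    · intro π hπ
      obtain ⟨π₁, h₁, π₂, h₂, rfl⟩ := (hprod π).1 (Finset.mem_filter.1 hπ)
      exact ⟨(π₁, π₂), Finset.mem_product.2 ⟨h₁, h₂⟩, rfl⟩
    · rintro ⟨π₁, π₂⟩ hp
      rw [Finset.mem_product] at hp
      exact hX.atom_mul_atom l he ε hJ hp.1 hp.2
  rw [hsplit, hX.entryMoment_eq l he, ← Finset.sum_filter_add_sum_filter_not (PM (I.map e))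
    (fun π => Connects π (signedSet (J.map e)) (signedSet (I.map e \ J.map e))),
    add_sub_cancel_right]
  refine Submodule.sum_mem _ fun π hπ => ?_
  rw [Finset.mem_filter] at hπ
  exact atom_mem_atomSpan (hX.isAtom l he ε I hπ.1)
    (links_premapRel he ε hJ (hX.isPremap _ hI π hπ.1) hπ.2)

end SingleEnsemble

/-! ### Independent ensembles -/

section IndependentEnsembles

variable {Ω κ : Type*} [MeasurableSpace Ω] {Λ : κ → Type*}

/-- The random matrix, of size `N + 1`, that belongs to a letter: a colour, a label of that colour
and a sign that is `-1` for the transpose. -/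
def letterMatrix (X : (c : κ) → (N : ℕ) → Λ c → Ω → Matrix (Fin N) (Fin N) ℂ) (N : ℕ)
    (x : Σ c, Λ c × ℤˣ) (ω : Ω) : Matrix (Fin (N + 1)) (Fin (N + 1)) ℂ :=
  signedMatrix x.2.2 (X x.1 (N + 1) x.2.1 ω)

/-- The mixed moments of the entries of the matrices with letters `L k`, at the positions `I`. -/
noncomputable def moment (P : Measure Ω)
    (X : (c : κ) → (N : ℕ) → Λ c → Ω → Matrix (Fin N) (Fin N) ℂ) {ι : Type*}
    (L : ι → Σ c, Λ c × ℤˣ) (I : Finset ι) (N : ℕ) (s : ι × Bool → Fin (N + 1)) : ℂ :=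
  ∫ ω, ∏ k ∈ I, letterMatrix X N (L k) ω (s (k, false)) (s (k, true)) ∂P

theorem signedMatrix_apply {N : ℕ} (ε : ℤˣ) (A : Matrix (Fin N) (Fin N) ℂ) (i j : Fin N) :
    signedMatrix ε A i j = if ε = 1 then A i j else A j i := by
  unfold signedMatrix
  split_ifs <;> rfl

theorem exists_pos_embedding (ι : Type*) [Fintype ι] : ∃ e : ι ↪ ℤ, ∀ k, 0 < e k := by
  refine ⟨(Fintype.equivFin ι).toEmbedding.trans
    ⟨fun i => (i : ℤ) + 1, fun i j h => Fin.ext (by simp only at h; omega)⟩, fun k => ?_⟩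
  show (0 : ℤ) < ((Fintype.equivFin ι k : ℕ) : ℤ) + 1
  positivity

variable {P : Measure Ω} {X : (c : κ) → (N : ℕ) → Λ c → Ω → Matrix (Fin N) (Fin N) ℂ}
  {ι : Type*}

theorem moment_empty [IsProbabilityMeasure P] (L : ι → Σ c, Λ c × ℤˣ) : moment P X L ∅ = 1 := by
  funext N s
  simp [moment]

/-- On positions of a single colour, `moment` is an `entryMoment` of one ensemble. -/
theorem exists_moment_eq_entryMoment (L : ι → Σ c, Λ c × ℤˣ) (c : κ) [Nonempty (Λ c)]
    (e : ι ↪ ℤ) : ∃ (l : ℤ → Λ c) (ε : ι → ℤˣ), ∀ I : Finset ι, (∀ k ∈ I, (L k).1 = c) →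
      moment P X L I = entryMoment P (X c) l e ε I := by
  classical
  -- A filler for positions of other colours, which `I` does not contain.
  let d : Λ c := Classical.arbitrary _
  let lab : ι → Λ c := fun k => if h : (L k).1 = c then h ▸ (L k).2.1 else d
  refine ⟨Function.extend e lab (fun _ => d), fun k => (L k).2.2, fun I hI => ?_⟩
  funext N s
  unfold moment entryMoment
  congr 1
  funext ω
  refine Finset.prod_congr rfl fun k hk => ?_
  rw [e.injective.extend_apply]
  have h : ∀ x : Σ c, Λ c × ℤˣ, ∀ h : x.1 = c,
      letterMatrix X N x ω = signedMatrix x.2.2 (X c (N + 1) (h ▸ x.2.1) ω) := by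
    rintro x rfl; rfl
  rw [h (L k) (hI k hk)]
  simp only [lab, hI k hk, dif_pos]

variable {PM : κ → Finset ℤ → Finset (Perm ℤ)}
  {f : (c : κ) → ℕ → (ℤ → Λ c) → Finset ℤ → Perm ℤ → ℂ}

theorem measurable_entries (hX : ∀ c, HasPremapExpansion P (X c) (PM c) (f c)) (c : κ) {N : ℕ}
    (hN : 0 < N) : Measurable (fun ω (l : Λ c) (i j : Fin N) => X c N l ω i j) :=
  measurable_pi_lambda _ fun l => measurable_pi_lambda _ fun i => measurable_pi_lambda _ fun j =>
    ((hX c).isRandomMatrix N hN l i j).1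

/-- The positions in `I` of colour `c`. -/
def ofColour [DecidableEq κ] (L : ι → Σ c, Λ c × ℤˣ) (I : Finset ι) (c : κ) : Finset ι :=
  I.filter (fun k => (L k).1 = c)

theorem colour_of_mem [DecidableEq κ] {L : ι → Σ c, Λ c × ℤˣ} {I : Finset ι} {c : κ} :
    ∀ k ∈ ofColour L I c, (L k).1 = c := fun _ hk => (Finset.mem_filter.1 hk).2

theorem moment_eq_prod [Fintype κ] [DecidableEq κ]
    (hX : ∀ c, HasPremapExpansion P (X c) (PM c) (f c))
    (hindep : ∀ N, 0 < N → iIndepFun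
      (fun (c : κ) (ω : Ω) (l : Λ c) (i j : Fin N) => X c N l ω i j) P)
    (L : ι → Σ c, Λ c × ℤˣ) (I : Finset ι) :
    moment P X L I = ∏ c, moment P X L (ofColour L I c) := by
  funext N s
  rw [Finset.prod_apply, Finset.prod_apply]
  -- For each colour, the factors as measurable functions of the entries of that ensemble alone, as
  -- independence requires.
  let g : (c : κ) → (Λ c → Fin (N + 1) → Fin (N + 1) → ℂ) → ι → ℂ := fun c Z k =>
    if h : (L k).1 = c then
      signedMatrix (L k).2.2 (Matrix.of (Z (h ▸ (L k).2.1))) (s (k, false)) (s (k, true)) else 0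
  have hg : ∀ c k, (L k).1 = c → ∀ ω, letterMatrix X N (L k) ω (s (k, false)) (s (k, true))
      = g c (fun l i j => X c (N + 1) l ω i j) k := by
    intro c k h ω
    simp only [g, h, dif_pos]
    have : ∀ x : Σ c, Λ c × ℤˣ, ∀ h : x.1 = c, letterMatrix X N x ω
        = signedMatrix x.2.2 (Matrix.of fun i j => X c (N + 1) (h ▸ x.2.1) ω i j) := by
      rintro x rfl; rfl
    rw [this (L k) h]
  have hmeas : ∀ c, Measurable (fun Z => ∏ k ∈ ofColour L I c, g c Z k) := by
    intro c
    refine Finset.measurable_prod _ fun k hk => ?_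
    have h := colour_of_mem k hk
    simp only [g, h, dif_pos]
    simp only [signedMatrix_apply]
    split_ifs <;> exact (measurable_pi_apply _).comp
      ((measurable_pi_apply _).comp (measurable_pi_apply _))
  have H := (hindep (N + 1) N.succ_pos).integral_fun_prod_comp
    (f := fun c Z => ∏ k ∈ ofColour L I c, g c Z k)
    (fun c => (measurable_entries hX c N.succ_pos).aemeasurable)
    (fun c => (hmeas c).aestronglyMeasurable)
  have hm : ∀ c, moment P X L (ofColour L I c) N s
      = ∫ ω, ∏ k ∈ ofColour L I c, g c (fun l i j => X c (N + 1) l ω i j) k ∂P := by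
    intro c
    unfold moment
    congr 1
    funext ω
    exact Finset.prod_congr rfl fun k hk => hg c k (colour_of_mem k hk) ω
  simp only [hm]
  rw [← H]
  unfold moment
  congr 1
  funext ω
  rw [← Finset.prod_fiberwise I (fun k => (L k).1)]
  refine Finset.prod_congr rfl fun c _ => ?_
  exact Finset.prod_congr rfl fun k hk => hg c k (colour_of_mem k hk) ω

variable [IsProbabilityMeasure P] [Fintype ι]

theorem moment_mem_of_colour (hX : ∀ c, HasPremapExpansion P (X c) (PM c) (f c))
    (L : ι → Σ c, Λ c × ℤˣ) (c : κ) {I : Finset ι} (hI : ∀ k ∈ I, (L k).1 = c) :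
    moment P X L I ∈ atomSpan I (fun _ => True) := by
  by_cases hc : Nonempty (Λ c)
  · obtain ⟨e, he⟩ := exists_pos_embedding ι
    obtain ⟨l, ε, h⟩ := exists_moment_eq_entryMoment (P := P) (X := X) L c e
    rw [h I hI]
    exact (hX c).entryMoment_mem l he ε I
  -- An ensemble without labels cannot occupy any position.
  · have : I = ∅ := Finset.eq_empty_of_forall_notMem fun k hk => hc ⟨hI k hk ▸ (L k).2.1⟩
    subst this
    rw [moment_empty]
    exact one_mem_atomSpan

variable [DecidableEq ι]

theorem moment_sub_mem_of_colour (hX : ∀ c, HasPremapExpansion P (X c) (PM c) (f c))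
    (L : ι → Σ c, Λ c × ℤˣ) (c : κ) {I J : Finset ι} (hI : ∀ k ∈ I, (L k).1 = c) (hJ : J ⊆ I) :
    moment P X L I - moment P X L J * moment P X L (I \ J) ∈ atomSpan I (Links J) := by
  by_cases hc : Nonempty (Λ c)
  · obtain ⟨e, he⟩ := exists_pos_embedding ι
    obtain ⟨l, ε, h⟩ := exists_moment_eq_entryMoment (P := P) (X := X) L c e
    rw [h I hI, h J fun k hk => hI k (hJ hk), h _ fun k hk => hI k (Finset.sdiff_subset hk)]
    exact (hX c).entryMoment_sub_mem l he ε hJ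
  · have : I = ∅ := Finset.eq_empty_of_forall_notMem fun k hk => hc ⟨hI k hk ▸ (L k).2.1⟩
    subst this
    rw [Finset.subset_empty.1 hJ, Finset.sdiff_self, moment_empty, mul_one, sub_self]
    exact Submodule.zero_mem _

theorem moment_rotationInvariant_of_colour (hX : ∀ c, HasPremapExpansion P (X c) (PM c) (f c))
    (L : ι → Σ c, Λ c × ℤˣ) (c : κ) {I : Finset ι} (hI : ∀ k ∈ I, (L k).1 = c) (N : ℕ) :
    RotationInvariant I (moment P X L I N) := by
  by_cases hc : Nonempty (Λ c)
  · obtain ⟨e, he⟩ := exists_pos_embedding ι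
    obtain ⟨l, ε, h⟩ := exists_moment_eq_entryMoment (P := P) (X := X) L c e
    rw [h I hI]
    exact (hX c).entryMoment_rotationInvariant l he ε I N
  · have : I = ∅ := Finset.eq_empty_of_forall_notMem fun k hk => hc ⟨hI k hk ▸ (L k).2.1⟩
    subst this
    intro A _ s
    simp

variable [DecidableEq κ]

theorem prod_moment_mem (hX : ∀ c, HasPremapExpansion P (X c) (PM c) (f c))
    (L : ι → Σ c, Λ c × ℤˣ) (I : Finset ι) (S : Finset κ) :
    ∏ c ∈ S, moment P X L (ofColour L I c)
      ∈ atomSpan (I.filter (fun k => (L k).1 ∈ S)) (fun _ => True) := by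
  induction S using Finset.induction_on with
  | empty =>
    simp only [Finset.prod_empty, Finset.notMem_empty, Finset.filter_false]
    exact one_mem_atomSpan
  | insert c S hc ih =>
    rw [Finset.prod_insert hc]
    have hI : I.filter (fun k => (L k).1 ∈ insert c S)
        = ofColour L I c ∪ I.filter (fun k => (L k).1 ∈ S) := by
      simp only [Finset.mem_insert, Finset.filter_or, ofColour]
    rw [hI]
    refine mul_mem_atomSpan ?_ (fun _ _ _ _ => trivial)
      (moment_mem_of_colour hX L c colour_of_mem) ih
    refine Finset.disjoint_filter.2 fun k _ h h' => hc (h ▸ h')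

/-- Colours are added one at a time by aA - bB = (a - b)A + b(A - B); each summand contains one
factor that links `J` to its complement. -/
theorem prod_moment_sub_mem (hX : ∀ c, HasPremapExpansion P (X c) (PM c) (f c))
    (L : ι → Σ c, Λ c × ℤˣ) {I J : Finset ι} (hJ : J ⊆ I) (S : Finset κ) :
    ∏ c ∈ S, moment P X L (ofColour L I c)
        - (∏ c ∈ S, moment P X L (ofColour L J c)) * ∏ c ∈ S, moment P X L (ofColour L (I \ J) c)
      ∈ atomSpan (I.filter (fun k => (L k).1 ∈ S)) (Links J) := by
  induction S using Finset.induction_on with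
  | empty =>
    simp only [Finset.prod_empty, mul_one, sub_self]
    exact Submodule.zero_mem _
  | insert c S hc ih =>
    rw [Finset.prod_insert hc, Finset.prod_insert hc, Finset.prod_insert hc]
    have hI : I.filter (fun k => (L k).1 ∈ insert c S)
        = ofColour L I c ∪ I.filter (fun k => (L k).1 ∈ S) := by
      simp only [Finset.mem_insert, Finset.filter_or, ofColour]
    have hdisj : Disjoint (ofColour L I c) (I.filter (fun k => (L k).1 ∈ S)) :=
      Finset.disjoint_filter.2 fun k _ h h' => hc (h ▸ h')
    have hsd : ofColour L (I \ J) c = ofColour L I c \ ofColour L J c := by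
      ext k; simp only [ofColour, Finset.mem_filter, Finset.mem_sdiff]; tauto
    have hJc : ofColour L J c ⊆ ofColour L I c := Finset.filter_subset_filter _ hJ
    have h1 := moment_sub_mem_of_colour hX L c (I := ofColour L I c) colour_of_mem hJc
    have h1' : moment P X L (ofColour L I c)
        - moment P X L (ofColour L J c) * moment P X L (ofColour L (I \ J) c)
        ∈ atomSpan (ofColour L I c) (Links J) := by
      rw [hsd]
      refine atomSpan_mono (fun r hr => ?_) h1
      rintro ⟨x, y, hxy, hx, hy⟩
      refine ⟨x, y, hxy, (Finset.mem_filter.1 hx).1, fun hy' => hy ?_⟩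
      exact Finset.mem_filter.2 ⟨hy', colour_of_mem _ (hr x y hxy).2⟩
    have h2 : moment P X L (ofColour L J c) * moment P X L (ofColour L (I \ J) c)
        ∈ atomSpan (ofColour L I c) (fun _ => True) := by
      have := mul_mem_atomSpan (R := fun _ => True) (I := ofColour L J c)
        (I' := ofColour L (I \ J) c) (hsd ▸ Finset.disjoint_sdiff) (fun _ _ _ _ => trivial)
        (moment_mem_of_colour hX L c colour_of_mem) (moment_mem_of_colour hX L c colour_of_mem)
      rwa [hsd, Finset.union_sdiff_of_subset hJc, ← hsd] at this
    have h3 := mul_mem_atomSpan (R := Links J) hdisj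
      (fun r r' ⟨x, y, hxy, hl⟩ _ => ⟨x, y, Or.inl hxy, hl⟩) h1' (prod_moment_mem hX L I S)
    have h4 := mul_mem_atomSpan (R := Links J) hdisj
      (fun r r' _ ⟨x, y, hxy, hl⟩ => ⟨x, y, Or.inr hxy, hl⟩) h2 ih
    rw [hI]
    convert Submodule.add_mem _ h3 h4 using 1
    ring

variable [Fintype κ]

theorem moment_mem (hX : ∀ c, HasPremapExpansion P (X c) (PM c) (f c))
    (hindep : ∀ N, 0 < N → iIndepFun
      (fun (c : κ) (ω : Ω) (l : Λ c) (i j : Fin N) => X c N l ω i j) P)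
    (L : ι → Σ c, Λ c × ℤˣ) (I : Finset ι) : moment P X L I ∈ atomSpan I (fun _ => True) := by
  rw [moment_eq_prod hX hindep]
  simpa using prod_moment_mem hX L I Finset.univ

theorem moment_sub_mem (hX : ∀ c, HasPremapExpansion P (X c) (PM c) (f c))
    (hindep : ∀ N, 0 < N → iIndepFun
      (fun (c : κ) (ω : Ω) (l : Λ c) (i j : Fin N) => X c N l ω i j) P)
    (L : ι → Σ c, Λ c × ℤˣ) {I J : Finset ι} (hJ : J ⊆ I) :
    moment P X L I - moment P X L J * moment P X L (I \ J) ∈ atomSpan I (Links J) := by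
  rw [moment_eq_prod hX hindep L I, moment_eq_prod hX hindep L J,
    moment_eq_prod hX hindep L (I \ J)]
  simpa using prod_moment_sub_mem hX L hJ Finset.univ

/-- By independence the moment is a product over the colours, and the factors of the other colours
do not involve the indices that are moved. -/
theorem moment_rotationInvariant (hX : ∀ c, HasPremapExpansion P (X c) (PM c) (f c))
    (hindep : ∀ N, 0 < N → iIndepFun
      (fun (c : κ) (ω : Ω) (l : Λ c) (i j : Fin N) => X c N l ω i j) P)
    (L : ι → Σ c, Λ c × ℤˣ) (I : Finset ι) (c : κ) (N : ℕ) :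
    RotationInvariant (ofColour L I c) (moment P X L I N) := by
  intro A hA s
  have h : ∀ x ∈ ofColour L I c ×ˢ (Finset.univ : Finset Bool), ∀ j,
      moment P X L I N (Function.update s x j)
        = moment P X L (ofColour L I c) N (Function.update s x j)
          * ∏ c' ∈ Finset.univ.erase c, moment P X L (ofColour L I c') N s := by
    intro x hx j
    rw [moment_eq_prod hX hindep, Finset.prod_apply, Finset.prod_apply,
      ← Finset.mul_prod_erase _ _ (Finset.mem_univ c)]
    congr 1
    refine Finset.prod_congr rfl fun c' hc' => ?_
    unfold moment
    congr 1
    funext ω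
    refine Finset.prod_congr rfl fun k hk => ?_
    have hkx : k ≠ x.1 := by
      rintro rfl
      exact (Finset.mem_erase.1 hc').1
        ((colour_of_mem _ hk).symm.trans (colour_of_mem _ (Finset.mem_product.1 hx).1))
    rw [Function.update_of_ne, Function.update_of_ne] <;> rintro rfl <;> exact hkx rfl
  rw [Finset.sum_congr rfl fun x hx => Finset.sum_congr rfl fun j _ => by
    rw [h x hx j, ← mul_assoc]]
  simp only [← Finset.sum_mul]
  rw [moment_rotationInvariant_of_colour hX L c colour_of_mem N A hA s, zero_mul]

end IndependentEnsembles

/-! ### Products and traces as sums over paths -/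

section Paths

variable {R : Type*} [CommRing R] {M : ℕ}

theorem prod_ofFn_apply {m : ℕ} (A : Fin (m + 1) → Matrix (Fin M) (Fin M) R) (a b : Fin M) :
    (List.ofFn A).prod a b = ∑ i : Fin m → Fin M, ∏ k,
      A k (Fin.cons (α := fun _ => Fin M) a i k) (Fin.snoc (α := fun _ => Fin M) i b k) := by
  induction m generalizing a with
  | zero =>
    simp [List.ofFn_succ, Fin.snoc]
  | succ m ih =>
    rw [List.ofFn_succ, List.prod_cons, Matrix.mul_apply]
    rw [← (Fin.consEquiv (fun _ : Fin (m + 1) => Fin M)).sum_comp, Fintype.sum_prod_type]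
    refine Finset.sum_congr rfl fun j _ => ?_
    rw [ih, Finset.mul_sum]
    refine Finset.sum_congr rfl fun i _ => ?_
    rw [Fin.prod_univ_succ (n := m + 1)]
    have hs : (Fin.snoc (α := fun _ => Fin M) (Fin.cons (α := fun _ => Fin M) j i) b :
        Fin (m + 1 + 1) → Fin M) = Fin.cons (α := fun _ => Fin M) j
          (Fin.snoc (α := fun _ => Fin M) i b) := (Fin.cons_snoc_eq_snoc_cons j i b).symm
    change _ = A 0 a ((Fin.snoc (α := fun _ => Fin M) (Fin.cons (α := fun _ => Fin M) j i) b :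
        Fin (m + 1 + 1) → Fin M) 0) * ∏ x : Fin (m + 1), A x.succ
          (Fin.cons (α := fun _ => Fin M) j i x)
          ((Fin.snoc (α := fun _ => Fin M) (Fin.cons (α := fun _ => Fin M) j i) b :
            Fin (m + 1 + 1) → Fin M) x.succ)
    simp only [hs, Fin.cons_zero, Fin.cons_succ]

theorem trace_prod_ofFn {m : ℕ} (A : Fin (m + 1) → Matrix (Fin M) (Fin M) R) :
    (List.ofFn A).prod.trace
      = ∑ i : Fin (m + 1) → Fin M, ∏ k, A k (i k) (i (finRotate (m + 1) k)) := by
  rw [← (Fin.consEquiv (fun _ : Fin (m + 1) => Fin M)).sum_comp, Fintype.sum_prod_type]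
  unfold Matrix.trace
  refine Finset.sum_congr rfl fun a _ => ?_
  rw [Matrix.diag_apply, prod_ofFn_apply]
  refine Finset.sum_congr rfl fun i _ => ?_
  simp only [Fin.consEquiv_apply, Fin.snoc_eq_cons_rotate]

end Paths

/-! ### Commutators along a product -/

section Commutators

variable {κ S : Type*} [Ring S] [DecidableEq κ]

/-- The sum, over the factors `A` of colour `c` in the product along `l`, of the product in which
`A` is replaced by `m * A - A * m`. -/
def commSum (m : S) (c : κ) : List (κ × S) → S
  | [] => 0
  | p :: l => (if p.1 = c then m * p.2 - p.2 * m else 0) * (l.map Prod.snd).prod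
      + p.2 * commSum m c l

/-- The Leibniz rule: replacing factors of colour `c` by their commutators acts as a derivation on
concatenations. -/
theorem commSum_append (m : S) (c : κ) (l l' : List (κ × S)) :
    commSum m c (l ++ l') = commSum m c l * (l'.map Prod.snd).prod
      + (l.map Prod.snd).prod * commSum m c l' := by
  induction l with
  | nil => simp [commSum]
  | cons p l ih =>
    simp only [List.cons_append, commSum, ih, List.map_append, List.prod_append, List.map_cons,
      List.prod_cons]
    noncomm_ring

theorem commSum_append_add (m : S) (c d : κ) (l l' : List (κ × S)) (B B' : S) :
    commSum m c (l ++ (d, B + B') :: l')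
      = commSum m c (l ++ (d, B) :: l') + commSum m c (l ++ (d, B') :: l') := by
  simp only [commSum_append, commSum, List.map_cons, List.prod_cons]
  split_ifs <;> simp only [mul_add, add_mul, sub_mul, mul_sub, zero_mul,
    mul_zero] <;> abel

theorem commSum_append_smul [Algebra ℂ S] (m : S) (c d : κ) (l l' : List (κ × S)) (r : ℂ) (B : S) :
    commSum m c (l ++ (d, r • B) :: l') = r • commSum m c (l ++ (d, B) :: l') := by
  simp only [commSum_append, commSum, List.map_cons, List.prod_cons]
  split_ifs <;> simp only [mul_smul_comm, smul_mul_assoc, zero_mul, zero_add, sub_mul] <;>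
    simp only [← smul_sub, ← smul_add, mul_smul_comm]

/-- Inside a block of one colour the commutators telescope. A block can therefore be treated as a
single factor, which is how words in the letters become polynomials. -/
theorem commSum_of_colour (m : S) (c d : κ) (l : List (κ × S)) (h : ∀ p ∈ l, p.1 = d) :
    commSum m c l
      = if d = c then m * (l.map Prod.snd).prod - (l.map Prod.snd).prod * m else 0 := by
  induction l with
  | nil => simp [commSum]
  | cons p l ih =>
    rw [commSum, ih fun q hq => h q (List.mem_cons_of_mem _ hq), h p List.mem_cons_self]
    split_ifs
    · simp only [List.map_cons, List.prod_cons]; noncomm_ring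
    · simp

theorem commSum_append_block (m : S) (c d : κ) (l l' l'' : List (κ × S)) (h : ∀ p ∈ l', p.1 = d) :
    commSum m c (l ++ l' ++ l'') = commSum m c (l ++ (d, (l'.map Prod.snd).prod) :: l'') := by
  rw [List.append_assoc, commSum_append, commSum_append, commSum_append, commSum,
    commSum_of_colour m c d l' h]
  simp

theorem commSum_ofFn (m : S) (c : κ) {n : ℕ} (d : Fin n → κ) (A : Fin n → S) :
    commSum m c (List.ofFn fun k => (d k, A k))
      = ∑ k with d k = c, (List.ofFn (Function.update A k (m * A k - A k * m))).prod := by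
  induction n with
  | zero => simp [commSum]
  | succ n ih =>
    rw [List.ofFn_succ, commSum, ih, Finset.sum_filter, Finset.sum_filter, Fin.sum_univ_succ,
      Finset.mul_sum, List.map_ofFn]
    congr 1
    · rw [ite_mul, zero_mul]
      refine if_congr Iff.rfl ?_ rfl
      rw [List.ofFn_succ, List.prod_cons, Function.update_self]
      congr 2
    · refine Finset.sum_congr rfl fun k _ => ?_
      rw [mul_ite, mul_zero]
      refine if_congr Iff.rfl ?_ rfl
      rw [List.ofFn_succ, List.prod_cons, Function.update_of_ne (Fin.succ_ne_zero k).symm]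
      congr 3
      funext j
      by_cases hj : j = k
      · subst hj; simp
      · rw [Function.update_of_ne hj, Function.update_of_ne (fun h => hj (Fin.succ_injective _ h))]

end Commutators

/-! ### Contraction of the commutators over all coordinate planes -/

section Contraction

variable {κ R : Type*} [CommRing R] [DecidableEq κ] {M : ℕ}

/-- The terms of the loop equation that are products of traces; `Q` is the product of the factors
to the left of `l`. -/
def splitSum (c : κ) : Matrix (Fin M) (Fin M) R → List (κ × Matrix (Fin M) (Fin M) R) → R
  | _, [] => 0
  | Q, p :: l => (if p.1 = c then Q.trace * (p.2 * (l.map Prod.snd).prod).trace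
      - (Q * p.2).trace * (l.map Prod.snd).prod.trace else 0) + splitSum c (Q * p.2) l

/-- The terms of the loop equation that are single traces. -/
def twistSum (c : κ) : Matrix (Fin M) (Fin M) R → List (κ × Matrix (Fin M) (Fin M) R) → R
  | _, [] => 0
  | Q, p :: l => (if p.1 = c then (Q * (p.2 * (l.map Prod.snd).prod).transpose).trace
      - (Q * p.2 * (l.map Prod.snd).prod.transpose).trace else 0) + twistSum c (Q * p.2) l

/-- The antisymmetric matrix that generates the rotations in the plane of `u` and `v`. -/
def rotationGenerator (u v : Fin M) : Matrix (Fin M) (Fin M) R :=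
  Matrix.single u v 1 - Matrix.single v u 1

/-- The unit at (u, v) contributes Q_uu T_vv, which splits into two traces; the unit at (v, u)
contributes Q_uv T_uv, which sums to a single trace with a transpose. -/
theorem sum_mul_rotationGenerator_mul (Q T : Matrix (Fin M) (Fin M) R) :
    ∑ u, ∑ v, (Q * rotationGenerator u v * T : Matrix (Fin M) (Fin M) R) u v
      = Q.trace * T.trace - (Q * T.transpose).trace := by
  have h : ∀ u v a b, (Q * Matrix.single a b 1 * T : Matrix (Fin M) (Fin M) R) u v = Q u a * T b v := by
    intro u v a b
    rw [Matrix.mul_assoc, Matrix.mul_apply, Finset.sum_eq_single a]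
    · rw [Matrix.single_mul_apply_same, one_mul]
    · intro c _ hc
      rw [Matrix.single_mul_apply_of_ne _ _ _ _ _ hc, mul_zero]
    · simp
  simp only [rotationGenerator, Matrix.mul_sub, Matrix.sub_mul, Matrix.sub_apply, h,
    Finset.sum_sub_distrib]
  congr 1
  simp only [Matrix.trace, Matrix.diag_apply, Finset.sum_mul_sum]

theorem sum_mul_commSum (c : κ) (Q : Matrix (Fin M) (Fin M) R)
    (l : List (κ × Matrix (Fin M) (Fin M) R)) :
    ∑ u, ∑ v, (Q * commSum (rotationGenerator u v) c l) u v
      = splitSum c Q l - twistSum c Q l := by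
  induction l generalizing Q with
  | nil => simp [commSum, splitSum, twistSum]
  | cons p l ih =>
    simp only [commSum, splitSum, twistSum, Matrix.mul_add, Matrix.add_apply,
      Finset.sum_add_distrib]
    simp only [← Matrix.mul_assoc]
    rw [ih]
    split_ifs
    · have h : ∀ u v : Fin M, Q * (rotationGenerator u v * p.2 - p.2 * rotationGenerator u v)
          * (l.map Prod.snd).prod
          = Q * rotationGenerator u v * (p.2 * (l.map Prod.snd).prod)
            - (Q * p.2) * rotationGenerator u v * (l.map Prod.snd).prod := by
        intro u v
        simp only [Matrix.mul_sub, Matrix.sub_mul, Matrix.mul_assoc]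
      simp only [h, Matrix.sub_apply, Finset.sum_sub_distrib, sum_mul_rotationGenerator_mul]
      ring
    · simp

end Contraction

/-! ### The loop equation -/

section LoopEquation

variable {𝓡 : Type*} [CommRing 𝓡] [Algebra ℂ 𝓡] (E : 𝓡 →ₗ[ℂ] ℂ) {𝓛 κ : Type*} [DecidableEq κ]
  {M : ℕ} (Z : 𝓛 → Matrix (Fin M) (Fin M) 𝓡) (col : 𝓛 → κ)

/-- The moments of the entries of the matrices `Z (L k)`, at the positions `k ∈ I`, under `E`. -/
def entryExpectation {ι : Type*} (L : ι → 𝓛) (I : Finset ι) (s : ι × Bool → Fin M) : ℂ :=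
  E (∏ k ∈ I, Z (L k) (s (k, false)) (s (k, true)))

variable {E Z col}

/-- Rotating the row index of a factor multiplies it by `A` on the left; rotating its column index
multiplies it by -A on the right, by antisymmetry. Together they form the commutator. -/
theorem sum_expectation_commutator_eq_zero {ι : Type*} [Fintype ι] [DecidableEq ι] {L : ι → 𝓛}
    {c : κ} (h : RotationInvariant (Finset.univ.filter fun k => col (L k) = c)
      (entryExpectation E Z L Finset.univ))
    {A : Matrix (Fin M) (Fin M) ℂ} (hA : A.transpose = -A) (s : ι × Bool → Fin M) :
    ∑ k with col (L k) = c, E (∏ j, Function.update (fun j => Z (L j)) k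
      (A.map (algebraMap ℂ 𝓡) * Z (L k) - Z (L k) * A.map (algebraMap ℂ 𝓡)) j
        (s (j, false)) (s (j, true))) = 0 := by
  rw [← h A hA s, Finset.sum_product]
  refine Finset.sum_congr rfl fun k _ => ?_
  set T := ∏ j ∈ Finset.univ.erase k, Z (L j) (s (j, false)) (s (j, true)) with hT
  have h1 : ∀ B : Matrix (Fin M) (Fin M) 𝓡, ∏ j, Function.update (fun j => Z (L j)) k B j
      (s (j, false)) (s (j, true)) = B (s (k, false)) (s (k, true)) * T := by
    intro B
    rw [← Finset.mul_prod_erase _ _ (Finset.mem_univ k), Function.update_self]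
    congr 1
    refine Finset.prod_congr rfl fun j hj => ?_
    rw [Function.update_of_ne (Finset.ne_of_mem_erase hj)]
  have h2 : ∀ b j, entryExpectation E Z L Finset.univ (Function.update s (k, b) j)
      = E (Z (L k) (Function.update s (k, b) j (k, false))
        (Function.update s (k, b) j (k, true)) * T) := by
    intro b j
    unfold entryExpectation
    rw [← Finset.mul_prod_erase _ _ (Finset.mem_univ k)]
    congr 2
    refine Finset.prod_congr rfl fun i hi => ?_
    have hne := Finset.ne_of_mem_erase hi
    rw [Function.update_of_ne, Function.update_of_ne] <;> intro h <;>
      exact hne (congrArg Prod.fst h)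
  have hA' : ∀ i j, A i j = -A j i := fun i j => by
    have := congrFun (congrFun hA j) i
    simpa using this
  rw [h1, Fintype.sum_bool]
  simp only [h2]
  rw [Matrix.sub_apply, sub_mul, map_sub, sub_eq_add_neg, add_comm]
  congr 1
  · rw [Matrix.mul_apply, Finset.sum_mul, map_sum, ← Finset.sum_neg_distrib]
    refine Finset.sum_congr rfl fun j _ => ?_
    rw [hA' (s (k, true)) j, Function.update_self, Function.update_of_ne (by simp),
      Matrix.map_apply, neg_mul, ← smul_eq_mul (A _ _), ← map_smul, Algebra.smul_def]
    congr 2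
    ring
  · rw [Matrix.mul_apply, Finset.sum_mul, map_sum]
    refine Finset.sum_congr rfl fun j _ => ?_
    rw [Function.update_self, Function.update_of_ne (by simp),
      Matrix.map_apply, ← smul_eq_mul (A _ _), ← map_smul, Algebra.smul_def, mul_assoc]

theorem expectation_commSum_word_eq_zero
    (hinv : ∀ (n : ℕ) (L : Fin n → 𝓛) (c : κ), RotationInvariant
      (Finset.univ.filter fun k => col (L k) = c) (entryExpectation E Z L Finset.univ))
    {A : Matrix (Fin M) (Fin M) ℂ} (hA : A.transpose = -A) (c : κ) (w : List 𝓛) (a b : Fin M) :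
    E (commSum (A.map (algebraMap ℂ 𝓡)) c (w.map fun x => (col x, Z x)) a b) = 0 := by
  obtain ⟨n, L, rfl⟩ : ∃ (n : ℕ) (L : Fin n → 𝓛), w = List.ofFn L :=
    ⟨_, w.get, (List.ofFn_get w).symm⟩
  rw [List.map_ofFn]
  change E (commSum _ c (List.ofFn fun k => (col (L k), Z (L k))) a b) = 0
  rw [commSum_ofFn _ c (fun k => col (L k)) (fun k => Z (L k)), Matrix.sum_apply, map_sum]
  cases n with
  | zero => simp
  | succ m =>
    simp only [prod_ofFn_apply, map_sum]
    rw [Finset.sum_comm]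
    refine Finset.sum_eq_zero fun i _ => ?_
    -- The identity holds for each path from `a` to `b` separately; the ends stay fixed because the
    -- later contraction pairs them with a generator depending on them.
    exact sum_expectation_commutator_eq_zero (hinv _ L c) hA fun x =>
      if x.2 then Fin.snoc (α := fun _ => Fin M) i b x.1
      else Fin.cons (α := fun _ => Fin M) a i x.1

/-- The span of the products of letters of colour `d`. -/
def colourSpan (Z : 𝓛 → Matrix (Fin M) (Fin M) 𝓡) (col : 𝓛 → κ) (d : κ) :
    Submodule ℂ (Matrix (Fin M) (Fin M) 𝓡) :=
  Submodule.span ℂ {B | ∃ w : List 𝓛, (∀ x ∈ w, col x = d) ∧ B = (w.map Z).prod}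

theorem expectation_commSum_eq_zero
    (hinv : ∀ (n : ℕ) (L : Fin n → 𝓛) (c : κ), RotationInvariant
      (Finset.univ.filter fun k => col (L k) = c) (entryExpectation E Z L Finset.univ))
    {A : Matrix (Fin M) (Fin M) ℂ} (hA : A.transpose = -A) (c : κ)
    (l : List (κ × Matrix (Fin M) (Fin M) 𝓡)) (hl : ∀ p ∈ l, p.2 ∈ colourSpan Z col p.1)
    (a b : Fin M) :
    E (commSum (A.map (algebraMap ℂ 𝓡)) c l a b) = 0 := by
  set m := A.map (algebraMap ℂ 𝓡) with hm
  -- The prefix `w` collects the letters into which the factors already treated have been expanded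
  -- by linearity.
  suffices H : ∀ w : List 𝓛, E (commSum m c ((w.map fun x => (col x, Z x)) ++ l) a b) = 0 from
    H []
  induction l with
  | nil =>
    intro w
    rw [List.append_nil]
    exact expectation_commSum_word_eq_zero hinv hA c w a b
  | cons p l ih =>
    intro w
    have ih := ih fun q hq => hl q (List.mem_cons_of_mem _ hq)
    obtain ⟨d, B⟩ := p
    have hB : B ∈ colourSpan Z col d := hl (d, B) List.mem_cons_self
    clear hl
    induction hB using Submodule.span_induction with
    | mem B hB =>
      obtain ⟨w', hw', rfl⟩ := hB
      rw [← ih (w ++ w'), List.map_append]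
      congr 2
      have h1 := commSum_append_block m c d (w.map fun x => (col x, Z x))
        (w'.map fun x => (col x, Z x)) l (fun q hq => by
          obtain ⟨x, hx, rfl⟩ := List.mem_map.1 hq
          exact hw' x hx)
      rw [h1, List.map_map]
      rfl
    | zero => simp [commSum_append, commSum]
    | add B B' _ _ h h' =>
      have : commSum m c ((w.map fun x => (col x, Z x)) ++ (d, B + B') :: l)
          = commSum m c ((w.map fun x => (col x, Z x)) ++ (d, B) :: l)
            + commSum m c ((w.map fun x => (col x, Z x)) ++ (d, B') :: l) :=
        commSum_append_add ..
      rw [this, Matrix.add_apply, map_add, h, h', add_zero]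
    | smul r B _ h =>
      have : commSum m c ((w.map fun x => (col x, Z x)) ++ (d, r • B) :: l)
          = r • commSum m c ((w.map fun x => (col x, Z x)) ++ (d, B) :: l) :=
        commSum_append_smul ..
      rw [this, Matrix.smul_apply, map_smul, h, smul_zero]

/-- The loop equation. For each plane (u, v) the expected (u, v) entry of the commutator sum with
the generator vanishes; summing over the planes leaves products of two traces against single traces.
-/
theorem expectation_splitSum_eq
    (hinv : ∀ (n : ℕ) (L : Fin n → 𝓛) (c : κ), RotationInvariant
      (Finset.univ.filter fun k => col (L k) = c) (entryExpectation E Z L Finset.univ))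
    (c : κ) (l : List (κ × Matrix (Fin M) (Fin M) 𝓡))
    (hl : ∀ p ∈ l, p.2 ∈ colourSpan Z col p.1) :
    E (splitSum c 1 l) = E (twistSum c 1 l) := by
  rw [← sub_eq_zero, ← map_sub, ← sum_mul_commSum, map_sum]
  refine Finset.sum_eq_zero fun u _ => ?_
  rw [map_sum]
  refine Finset.sum_eq_zero fun v _ => ?_
  rw [Matrix.one_mul]
  have hA : (rotationGenerator u v : Matrix (Fin M) (Fin M) ℂ).transpose
      = -rotationGenerator u v := by
    simp [rotationGenerator, Matrix.transpose_sub, Matrix.transpose_single]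
  have hmap : (rotationGenerator u v : Matrix (Fin M) (Fin M) ℂ).map (algebraMap ℂ 𝓡)
      = rotationGenerator u v := by
    simp [rotationGenerator, Matrix.map_sub, Matrix.map_single]
  rw [← hmap]
  exact expectation_commSum_eq_zero hinv hA c l hl u v

end LoopEquation

/-! ### Asymptotic estimates -/

section Asymptotics

variable {𝓡 : Type*} [CommRing 𝓡] [Algebra ℂ 𝓡] {𝓛 κ : Type*}

/-- The mixed moments of the entries of the matrices `Z N x`, `x` a letter of colour `col x`, have
an expansion of the kind that independent ensembles with premap expansions have. -/
structure HasMomentExpansion [DecidableEq κ] (E : 𝓡 →ₗ[ℂ] ℂ)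
    (Z : (N : ℕ) → 𝓛 → Matrix (Fin (N + 1)) (Fin (N + 1)) 𝓡) (col : 𝓛 → κ) : Prop where
  map_one : E 1 = 1
  mem : ∀ {ι : Type} [Fintype ι] [DecidableEq ι] (L : ι → 𝓛),
    (fun N => entryExpectation E (Z N) L Finset.univ) ∈ atomSpan Finset.univ (fun _ => True)
  sub_mem : ∀ {ι : Type} [Fintype ι] [DecidableEq ι] (L : ι → 𝓛) (J : Finset ι),
    ((fun N => entryExpectation E (Z N) L Finset.univ)
      - (fun N => entryExpectation E (Z N) L J) *
        fun N => entryExpectation E (Z N) L (Finset.univ \ J)) ∈ atomSpan Finset.univ (Links J)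
  rotationInvariant : ∀ {ι : Type} [Fintype ι] [DecidableEq ι] (L : ι → 𝓛) (c : κ) (N : ℕ),
    RotationInvariant (Finset.univ.filter fun k => col (L k) = c)
      (entryExpectation E (Z N) L Finset.univ)
  exists_transpose : ∀ x, ∃ x', col x' = col x ∧ ∀ N, Z N x' = (Z N x).transpose

/-- The index assignment of a family of closed paths: at the position `k` the two indices are
`i k` and `i (g k)`. -/
def pathHom {ι : Type*} (g : Perm ι) (N : ℕ) :
    (ι → Fin (N + 1)) →+ (ι × Bool → Fin (N + 1)) where
  toFun i x := i (if x.2 then g x.1 else x.1)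
  map_zero' := rfl
  map_add' _ _ := rfl

/-- A closed path along which every step is diagonal is constant, which leaves N + 1 choices. -/
theorem eq_zero_of_finRotate {α : Type*} {m : ℕ} {i : Fin (m + 1) → α}
    (h : ∀ k, i k = i (finRotate (m + 1) k)) (k : Fin (m + 1)) : i k = i 0 := by
  induction k using Fin.induction with
  | zero => rfl
  | succ k ih => rw [← ih, h k.castSucc, finRotate_apply, Fin.coeSucc_eq_succ]

theorem eq_of_mem_diagonal {ι : Type*} [Fintype ι] {g : Perm ι} {N : ℕ} {i : ι → Fin (N + 1)}
    (h : pathHom g N i ∈ diagonal N Finset.univ) (k : ι) : i k = i (g k) :=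
  mem_diagonal.1 h k (Finset.mem_univ k)

variable {E : 𝓡 →ₗ[ℂ] ℂ} {Z : (N : ℕ) → 𝓛 → Matrix (Fin (N + 1)) (Fin (N + 1)) 𝓡} {col : 𝓛 → κ}

theorem expectation_trace_one (N : ℕ) (g : 𝓡) :
    E ((1 : Matrix (Fin (N + 1)) (Fin (N + 1)) 𝓡).trace * g) = (N + 1) * E g := by
  rw [Matrix.trace_one, Fintype.card_fin, ← nsmul_eq_mul, map_nsmul, nsmul_eq_mul]
  push_cast
  rfl

/-- Sequences of matrices that are polynomials, with coefficients that are bounded in `N`, in the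
letters from `S`. -/
inductive IsPolynomial (Z : (N : ℕ) → 𝓛 → Matrix (Fin (N + 1)) (Fin (N + 1)) 𝓡) (S : Set 𝓛) :
    ((N : ℕ) → Matrix (Fin (N + 1)) (Fin (N + 1)) 𝓡) → Prop
  | word (w : List 𝓛) (hw : ∀ x ∈ w, x ∈ S) : IsPolynomial Z S fun N => (w.map (Z N)).prod
  | smul (β : ℕ → ℂ) (K : ℝ) (hβ : ∀ N, ‖β N‖ ≤ K) (A) (hA : IsPolynomial Z S A) :
      IsPolynomial Z S fun N => β N • A N
  | add (A B) (hA : IsPolynomial Z S A) (hB : IsPolynomial Z S B) : IsPolynomial Z S (A + B)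

namespace IsPolynomial

variable {S T : Set 𝓛} {A B : (N : ℕ) → Matrix (Fin (N + 1)) (Fin (N + 1)) 𝓡}

theorem mono (hST : S ⊆ T) (hA : IsPolynomial Z S A) : IsPolynomial Z T A := by
  induction hA with
  | word w hw => exact word w fun x hx => hST (hw x hx)
  | smul β K hβ A _ ih => exact smul β K hβ A ih
  | add A B _ _ ihA ihB => exact add A B ihA ihB

theorem one : IsPolynomial Z S 1 := word [] (by simp)

theorem letter {x : 𝓛} (hx : x ∈ S) : IsPolynomial Z S fun N => Z N x := by
  have := word (Z := Z) (S := S) [x] (by simpa using hx)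
  simpa using this

theorem mul (hA : IsPolynomial Z S A) (hB : IsPolynomial Z S B) : IsPolynomial Z S (A * B) := by
  induction hA with
  | word w hw =>
    induction hB with
    | word w' hw' =>
      have := word (Z := Z) (S := S) (w ++ w') (by
        intro x hx
        rcases List.mem_append.1 hx with hx | hx
        exacts [hw x hx, hw' x hx])
      simp only [List.map_append, List.prod_append] at this
      exact this
    | smul β K hβ B _ ih =>
      convert smul β K hβ _ ih using 1
      funext N; simp
    | add B B' _ _ ihB ihB' =>
      convert add _ _ ihB ihB' using 1
      rw [mul_add]
  | smul β K hβ A _ ih =>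
    convert smul β K hβ _ ih using 1
    funext N; simp
  | add A A' _ _ ihA ihA' =>
    convert add _ _ ihA ihA' using 1
    rw [add_mul]

theorem sub_smul_one (hA : IsPolynomial Z S A) {β : ℕ → ℂ} {K : ℝ} (hβ : ∀ N, ‖β N‖ ≤ K) :
    IsPolynomial Z S fun N => A N - β N • 1 := by
  have := add _ _ hA (smul (fun N => -β N) K (fun N => by rw [norm_neg]; exact hβ N) 1 one)
  convert this using 1
  funext N
  simp [sub_eq_add_neg]

theorem listProd {l : List ((N : ℕ) → Matrix (Fin (N + 1)) (Fin (N + 1)) 𝓡)}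
    (hl : ∀ A ∈ l, IsPolynomial Z S A) : IsPolynomial Z S l.prod := by
  induction l with
  | nil => exact one
  | cons A l ih =>
    rw [List.prod_cons]
    exact (hl A List.mem_cons_self).mul (ih fun B hB => hl B (List.mem_cons_of_mem _ hB))

theorem apply_mem_colourSpan {d : κ} (hA : IsPolynomial Z {x | col x = d} A) (N : ℕ) :
    A N ∈ colourSpan (Z N) col d := by
  induction hA with
  | word w hw => exact Submodule.subset_span ⟨w, hw, rfl⟩
  | smul β K hβ A _ ih => exact Submodule.smul_mem _ _ ih
  | add A B _ _ ihA ihB => exact Submodule.add_mem _ ihA ihB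

end IsPolynomial

/-! ### Orders of magnitude of expected traces and covariances -/

variable [DecidableEq κ]

/-- The trace is a sum over closed paths, so up to a constant it is bounded by the number of
constant paths. The empty word has no path and is treated apart. -/
theorem HasMomentExpansion.exists_norm_word_le (h : HasMomentExpansion E Z col) (w : List 𝓛) :
    ∃ K : ℝ, ∀ N : ℕ, ‖E ((w.map (Z N)).prod.trace)‖ ≤ K * (N + 1) := by
  obtain ⟨n, L, rfl⟩ : ∃ (n : ℕ) (L : Fin n → 𝓛), w = List.ofFn L :=
    ⟨_, w.get, (List.ofFn_get w).symm⟩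
  simp only [List.map_ofFn]
  cases n with
  | zero =>
    refine ⟨1, fun N => ?_⟩
    have := expectation_trace_one (E := E) N (1 : 𝓡)
    rw [mul_one, h.map_one] at this
    rw [List.ofFn_zero, List.prod_nil, this, mul_one, one_mul]
    exact_mod_cast (Complex.norm_natCast (N + 1)).le
  | succ m =>
    obtain ⟨K, hK⟩ := exists_norm_sum_le (h.mem L) (pathHom (finRotate (m + 1)))
      (fun N => (N : ℝ) + 1) (fun r _ N => by
        have := Nat.card_le_card_of_injective
          (fun i : ↥((respecting N r ⊓ diagonal N Finset.univ).comap
            (pathHom (finRotate (m + 1)) N)) => i.1 0) (fun i j hij => by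
              refine Subtype.ext (funext fun k => ?_)
              have hij : i.1 0 = j.1 0 := hij
              rw [eq_zero_of_finRotate (eq_of_mem_diagonal i.2.2) k, hij,
                eq_zero_of_finRotate (eq_of_mem_diagonal j.2.2) k])
        rw [Nat.card_fin] at this
        exact_mod_cast this)
    refine ⟨K, fun N => ?_⟩
    rw [trace_prod_ofFn, map_sum]
    exact hK N

/-- A diagonal pair of closed paths is a pair of constants. Every relation left in the covariance
links the two paths and equates the constants, so N + 1 choices remain instead of (N + 1)². If a
word is empty, its trace is deterministic and the covariance is 0. -/
theorem HasMomentExpansion.exists_norm_covariance_word_le (h : HasMomentExpansion E Z col)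
    (w w' : List 𝓛) :
    ∃ K : ℝ, ∀ N : ℕ, ‖E ((w.map (Z N)).prod.trace * (w'.map (Z N)).prod.trace)
      - E ((w.map (Z N)).prod.trace) * E ((w'.map (Z N)).prod.trace)‖ ≤ K * (N + 1) := by
  obtain ⟨n, L, rfl⟩ : ∃ (n : ℕ) (L : Fin n → 𝓛), w = List.ofFn L :=
    ⟨_, w.get, (List.ofFn_get w).symm⟩
  obtain ⟨n', L', rfl⟩ : ∃ (n : ℕ) (L : Fin n → 𝓛), w' = List.ofFn L :=
    ⟨_, w'.get, (List.ofFn_get w').symm⟩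
  simp only [List.map_ofFn]
  cases n with
  | zero =>
    refine ⟨0, fun N => ?_⟩
    have := expectation_trace_one (E := E) N (1 : 𝓡)
    rw [mul_one, h.map_one] at this
    rw [List.ofFn_zero, List.prod_nil, expectation_trace_one, this, mul_one, sub_self]
    simp
  | succ m =>
  cases n' with
  | zero =>
    refine ⟨0, fun N => ?_⟩
    have := expectation_trace_one (E := E) N (1 : 𝓡)
    rw [mul_one, h.map_one] at this
    rw [List.ofFn_zero, List.prod_nil, mul_comm, expectation_trace_one, this, mul_one,
      mul_comm, sub_self]
    simp
  | succ m' =>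
    set J : Finset (Fin (m + 1) ⊕ Fin (m' + 1)) := Finset.univ.map Function.Embedding.inl with hJ
    set g : Perm (Fin (m + 1) ⊕ Fin (m' + 1)) :=
      Equiv.sumCongr (finRotate (m + 1)) (finRotate (m' + 1)) with hg
    have hJc : Finset.univ \ J = Finset.univ.map Function.Embedding.inr := by
      ext k; rcases k with k | k <;> simp [hJ]
    have hconst : ∀ {N : ℕ} {i : Fin (m + 1) ⊕ Fin (m' + 1) → Fin (N + 1)},
        pathHom g N i ∈ diagonal N Finset.univ →
          (∀ k, i (Sum.inl k) = i (Sum.inl 0)) ∧ ∀ k, i (Sum.inr k) = i (Sum.inr 0) := by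
      intro N i hi
      exact ⟨eq_zero_of_finRotate (i := fun k => i (Sum.inl k))
          (fun k => eq_of_mem_diagonal hi (Sum.inl k)),
        eq_zero_of_finRotate (i := fun k => i (Sum.inr k))
          (fun k => eq_of_mem_diagonal hi (Sum.inr k))⟩
    have hlink : ∀ {N : ℕ} {r} (_ : Links J r) {i : Fin (m + 1) ⊕ Fin (m' + 1) → Fin (N + 1)},
        pathHom g N i ∈ respecting N r ⊓ diagonal N Finset.univ →
          i (Sum.inl 0) = i (Sum.inr 0) := by
      rintro N r ⟨⟨x, b⟩, ⟨y, b'⟩, hxy, hx, hy⟩ i hi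
      have hc := hconst hi.2
      have hs : pathHom g N i (x, b) = pathHom g N i (y, b') := hi.1 _ _ hxy
      obtain ⟨x, -, rfl⟩ := Finset.mem_map.1 hx
      rcases y with y | y
      · simp [hJ] at hy
      · have h1 : pathHom g N i (Sum.inl x, b) = i (Sum.inl 0) := by
          cases b
          · exact hc.1 _
          · exact hc.1 _
        have h2 : pathHom g N i (Sum.inr y, b') = i (Sum.inr 0) := by
          cases b'
          · exact hc.2 _
          · exact hc.2 _
        rw [← h1, ← h2]; exact hs
    obtain ⟨K, hK⟩ := exists_norm_sum_le (h.sub_mem (Sum.elim L L') J) (pathHom g)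
      (fun N => (N : ℝ) + 1) (fun r hr N => by
        have := Nat.card_le_card_of_injective
          (fun i : ↥((respecting N r ⊓ diagonal N Finset.univ).comap (pathHom g N)) =>
            i.1 (Sum.inl 0)) (fun i j hij => by
              refine Subtype.ext (funext fun k => ?_)
              have hi := hconst i.2.2
              have hj := hconst j.2.2
              have hij : i.1 (Sum.inl 0) = j.1 (Sum.inl 0) := hij
              rcases k with k | k
              · rw [hi.1 k, hij, hj.1 k]
              · rw [hi.2 k, ← hlink hr i.2, hij, hlink hr j.2, hj.2 k])
        rw [Nat.card_fin] at this
        exact_mod_cast this)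
    refine ⟨K, fun N => ?_⟩
    convert hK N using 2
    rw [trace_prod_ofFn, trace_prod_ofFn, ← (sumArrowEquivProdArrow _ _ _).symm.sum_comp,
      Fintype.sum_prod_type, Finset.sum_mul_sum, map_sum, map_sum, map_sum, Finset.sum_mul_sum,
      ← Finset.sum_sub_distrib]
    refine Finset.sum_congr rfl fun i _ => ?_
    rw [map_sum, ← Finset.sum_sub_distrib]
    refine Finset.sum_congr rfl fun i' _ => ?_
    simp only [Pi.sub_apply, Pi.mul_apply, entryExpectation, hJc]
    rw [hJ, Finset.prod_map, Finset.prod_map, Fintype.prod_sum_type]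
    rfl

namespace IsPolynomial

variable {S : Set 𝓛} {A B : (N : ℕ) → Matrix (Fin (N + 1)) (Fin (N + 1)) 𝓡}

theorem transpose (h : HasMomentExpansion E Z col) (hA : IsPolynomial Z Set.univ A) :
    IsPolynomial Z Set.univ fun N => (A N).transpose := by
  induction hA with
  | word w _ =>
    induction w with
    | nil =>
      convert one (Z := Z) (S := Set.univ) using 1
      funext N
      simp
    | cons x w ih =>
      obtain ⟨x', -, hx'⟩ := h.exists_transpose x
      have := (ih fun _ _ => trivial).mul (letter (Z := Z) (Set.mem_univ x'))
      convert this using 1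
      funext N
      simp [Matrix.transpose_mul, hx']
  | smul β K hβ A _ ih =>
    convert smul β K hβ _ ih using 1
    funext N
    exact Matrix.transpose_smul _ _
  | add A B _ _ ihA ihB =>
    convert add _ _ ihA ihB using 1
    funext N
    exact Matrix.transpose_add _ _

theorem exists_norm_trace_le (h : HasMomentExpansion E Z col) (hA : IsPolynomial Z S A) :
    ∃ K : ℝ, ∀ N : ℕ, ‖E (A N).trace‖ ≤ K * (N + 1) := by
  induction hA with
  | word w _ => exact h.exists_norm_word_le w
  | smul β K hβ A _ ih =>
    obtain ⟨K', hK'⟩ := ih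
    refine ⟨K * K', fun N => ?_⟩
    rw [Matrix.trace_smul, map_smul, norm_smul, mul_assoc]
    exact mul_le_mul (hβ N) (hK' N) (norm_nonneg _) ((norm_nonneg _).trans (hβ N))
  | add A B _ _ ihA ihB =>
    obtain ⟨K, hK⟩ := ihA
    obtain ⟨K', hK'⟩ := ihB
    refine ⟨K + K', fun N => ?_⟩
    rw [Pi.add_apply, Matrix.trace_add, map_add, add_mul]
    exact (norm_add_le _ _).trans (add_le_add (hK N) (hK' N))

theorem exists_norm_covariance_le (h : HasMomentExpansion E Z col) (hA : IsPolynomial Z S A)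
    (hB : IsPolynomial Z S B) : ∃ K : ℝ, ∀ N : ℕ,
      ‖E ((A N).trace * (B N).trace) - E (A N).trace * E (B N).trace‖ ≤ K * (N + 1) := by
  induction hA with
  | word w _ =>
    induction hB with
    | word w' _ => exact h.exists_norm_covariance_word_le w w'
    | smul β K hβ B _ ih =>
      obtain ⟨K', hK'⟩ := ih
      refine ⟨K * K', fun N => ?_⟩
      rw [Matrix.trace_smul, mul_smul_comm, map_smul, map_smul, mul_smul_comm, ← smul_sub,
        norm_smul, mul_assoc]
      exact mul_le_mul (hβ N) (hK' N) (norm_nonneg _) ((norm_nonneg _).trans (hβ N))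
    | add B B' _ _ ihB ihB' =>
      obtain ⟨K, hK⟩ := ihB
      obtain ⟨K', hK'⟩ := ihB'
      refine ⟨K + K', fun N => ?_⟩
      rw [Pi.add_apply, Matrix.trace_add, mul_add, map_add, map_add, mul_add, add_sub_add_comm,
        add_mul]
      exact (norm_add_le _ _).trans (add_le_add (hK N) (hK' N))
  | smul β K hβ A _ ih =>
    obtain ⟨K', hK'⟩ := ih
    refine ⟨K * K', fun N => ?_⟩
    rw [Matrix.trace_smul, smul_mul_assoc, map_smul, map_smul, smul_mul_assoc, ← smul_sub,
      norm_smul, mul_assoc]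
    exact mul_le_mul (hβ N) (hK' N) (norm_nonneg _) ((norm_nonneg _).trans (hβ N))
  | add A A' _ _ ihA ihA' =>
    obtain ⟨K, hK⟩ := ihA
    obtain ⟨K', hK'⟩ := ihA'
    refine ⟨K + K', fun N => ?_⟩
    rw [Pi.add_apply, Matrix.trace_add, add_mul, map_add, map_add, add_mul, add_sub_add_comm,
      add_mul]
    exact (norm_add_le _ _).trans (add_le_add (hK N) (hK' N))

end IsPolynomial

end Asymptotics

/-! ### Freeness from the loop equation -/

section Freeness

variable {𝓡 : Type*} [CommRing 𝓡] {𝓛 κ : Type*}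

/-- The matrices of size `N + 1` in a list of sequences. -/
def evalList (N : ℕ) (l : List (κ × ((N : ℕ) → Matrix (Fin (N + 1)) (Fin (N + 1)) 𝓡))) :
    List (κ × Matrix (Fin (N + 1)) (Fin (N + 1)) 𝓡) :=
  l.map fun p => (p.1, p.2 N)

theorem prod_evalList (N : ℕ)
    (l : List (κ × ((N : ℕ) → Matrix (Fin (N + 1)) (Fin (N + 1)) 𝓡))) :
    ((evalList N l).map Prod.snd).prod = (l.map Prod.snd).prod N := by
  induction l with
  | nil => rfl
  | cons p l ih =>
    rw [List.map_cons, List.prod_cons, Pi.mul_apply, ← ih]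
    rfl

variable [Algebra ℂ 𝓡]

/-- The expected normalized trace of a sequence of matrices. -/
noncomputable def meanTrace (E : 𝓡 →ₗ[ℂ] ℂ)
    (A : (N : ℕ) → Matrix (Fin (N + 1)) (Fin (N + 1)) 𝓡) (N : ℕ) : ℂ :=
  E (A N).trace / (N + 1)

theorem norm_natCast_add_one (N : ℕ) : ‖(N : ℂ) + 1‖ = (N : ℝ) + 1 := by
  exact_mod_cast Complex.norm_natCast (N + 1)

variable {E : 𝓡 →ₗ[ℂ] ℂ} {Z : (N : ℕ) → 𝓛 → Matrix (Fin (N + 1)) (Fin (N + 1)) 𝓡} {col : 𝓛 → κ}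

theorem meanTrace_one (hE : E 1 = 1) (N : ℕ) : meanTrace E 1 N = 1 := by
  have := expectation_trace_one (E := E) N 1
  rw [mul_one, hE, mul_one] at this
  unfold meanTrace
  rw [Pi.one_apply, this, div_self (Nat.cast_add_one_ne_zero (R := ℂ) N)]

theorem meanTrace_sub_smul_one (hE : E 1 = 1)
    (A : (N : ℕ) → Matrix (Fin (N + 1)) (Fin (N + 1)) 𝓡) :
    meanTrace E (fun N => A N - meanTrace E A N • 1) = 0 := by
  funext N
  have h1 : E (1 : Matrix (Fin (N + 1)) (Fin (N + 1)) 𝓡).trace / (N + 1) = 1 := meanTrace_one hE N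
  change E (A N - meanTrace E A N • 1).trace / (N + 1) = 0
  rw [Matrix.trace_sub, Matrix.trace_smul, map_sub, map_smul, sub_div, smul_eq_mul, mul_div_assoc,
    h1, mul_one]
  exact sub_self _

variable {S : Set 𝓛} {l l' : List (κ × ((N : ℕ) → Matrix (Fin (N + 1)) (Fin (N + 1)) 𝓡))}

theorem isPolynomial_prod (hl : ∀ p ∈ l, IsPolynomial Z Set.univ p.2) :
    IsPolynomial Z Set.univ (l.map Prod.snd).prod := by
  refine IsPolynomial.listProd fun A hA => ?_
  obtain ⟨p, hp, rfl⟩ := List.mem_map.1 hA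
  exact hl p hp

/-- An alternating list of centred polynomials. -/
def IsAlternatingCentred (E : 𝓡 →ₗ[ℂ] ℂ)
    (Z : (N : ℕ) → 𝓛 → Matrix (Fin (N + 1)) (Fin (N + 1)) 𝓡) (col : 𝓛 → κ)
    (l : List (κ × ((N : ℕ) → Matrix (Fin (N + 1)) (Fin (N + 1)) 𝓡))) : Prop :=
  l.IsChain (fun p q => p.1 ≠ q.1) ∧
    ∀ p ∈ l, IsPolynomial Z {x | col x = p.1} p.2 ∧ meanTrace E p.2 = 0

theorem IsAlternatingCentred.infix (h : IsAlternatingCentred E Z col l) (hl : l' <:+: l) :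
    IsAlternatingCentred E Z col l' :=
  ⟨h.1.infix hl, fun p hp => h.2 p (hl.subset hp)⟩

theorem IsAlternatingCentred.isPolynomial_prod (h : IsAlternatingCentred E Z col l) :
    IsPolynomial Z Set.univ (l.map Prod.snd).prod :=
  PremapFreeness.isPolynomial_prod fun p hp => (h.2 p hp).1.mono (Set.subset_univ _)

/-! ### The limiting loop equation and the induction on alternating products -/

variable [DecidableEq κ]

/-- The loop equation in the limit, where expectations of products of traces factorize. -/
noncomputable def splitLim (E : 𝓡 →ₗ[ℂ] ℂ) (c : κ) :
    ((N : ℕ) → Matrix (Fin (N + 1)) (Fin (N + 1)) 𝓡) →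
      List (κ × ((N : ℕ) → Matrix (Fin (N + 1)) (Fin (N + 1)) 𝓡)) → ℕ → ℂ
  | _, [] => 0
  | Q, p :: l => (if p.1 = c then meanTrace E Q * meanTrace E (p.2 * (l.map Prod.snd).prod)
      - meanTrace E (Q * p.2) * meanTrace E (l.map Prod.snd).prod else 0)
        + splitLim E c (Q * p.2) l

variable {A B Q : (N : ℕ) → Matrix (Fin (N + 1)) (Fin (N + 1)) 𝓡}

theorem IsPolynomial.exists_norm_meanTrace_le (h : HasMomentExpansion E Z col)
    (hA : IsPolynomial Z S A) : ∃ K : ℝ, ∀ N : ℕ, ‖meanTrace E A N‖ ≤ K := by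
  obtain ⟨K, hK⟩ := hA.exists_norm_trace_le h
  refine ⟨K, fun N => ?_⟩
  rw [meanTrace, norm_div, norm_natCast_add_one, div_le_iff₀ (by positivity)]
  exact hK N

theorem IsPolynomial.exists_norm_sub_le (h : HasMomentExpansion E Z col)
    (hA : IsPolynomial Z S A) (hB : IsPolynomial Z S B) : ∃ K : ℝ, ∀ N : ℕ,
      ‖E ((A N).trace * (B N).trace) / ((N : ℂ) + 1) ^ 2 - meanTrace E A N * meanTrace E B N‖
        ≤ K / (N + 1) := by
  obtain ⟨K, hK⟩ := hA.exists_norm_covariance_le h hB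
  refine ⟨K, fun N => ?_⟩
  have h1 : E ((A N).trace * (B N).trace) / ((N : ℂ) + 1) ^ 2
      - meanTrace E A N * meanTrace E B N
      = (E ((A N).trace * (B N).trace) - E (A N).trace * E (B N).trace) / ((N : ℂ) + 1) ^ 2 := by
    unfold meanTrace
    have := Nat.cast_add_one_ne_zero (R := ℂ) N
    field_simp
  have hp : (0 : ℝ) < (N : ℝ) + 1 := by positivity
  rw [h1, norm_div, norm_pow, norm_natCast_add_one, div_le_div_iff₀ (by positivity) hp]
  calc _ ≤ K * (N + 1) * (N + 1) := mul_le_mul_of_nonneg_right (hK N) hp.le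
    _ = _ := by ring

/-- Letters are closed under transposition, so each term is a single trace of a polynomial and hence
O(N), negligible against N². -/
theorem exists_norm_twistSum_le (h : HasMomentExpansion E Z col) (c : κ)
    (hl : ∀ p ∈ l, IsPolynomial Z Set.univ p.2) (hQ : IsPolynomial Z Set.univ Q) :
    ∃ K : ℝ, ∀ N : ℕ, ‖E (twistSum c (Q N) (evalList N l))‖ ≤ K * (N + 1) := by
  induction l generalizing Q with
  | nil => exact ⟨0, fun N => by simp [evalList, twistSum]⟩
  | cons p l ih =>
    have hp := hl p List.mem_cons_self
    have hl' : ∀ q ∈ l, IsPolynomial Z Set.univ q.2 := fun q hq => hl q (List.mem_cons_of_mem _ hq)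
    obtain ⟨K, hK⟩ := ih hl' (hQ.mul hp)
    have hprod := isPolynomial_prod hl'
    obtain ⟨K₁, hK₁⟩ := (hQ.mul ((hp.mul hprod).transpose h)).exists_norm_trace_le h
    obtain ⟨K₂, hK₂⟩ := ((hQ.mul hp).mul (hprod.transpose h)).exists_norm_trace_le h
    have h0 : ∀ N, E (twistSum c (Q N) (evalList N (p :: l))) = (if p.1 = c then
        E ((Q * fun N => ((p.2 * (l.map Prod.snd).prod) N).transpose) N).trace
          - E ((Q * p.2 * fun N => ((l.map Prod.snd).prod N).transpose) N).trace else 0)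
        + E (twistSum c ((Q * p.2) N) (evalList N l)) := by
      intro N
      rw [evalList, List.map_cons, twistSum, map_add]
      change E (if p.1 = c then (Q N * (p.2 N * ((evalList N l).map Prod.snd).prod).transpose).trace
        - (Q N * p.2 N * ((evalList N l).map Prod.snd).prod.transpose).trace else 0) + _ = _
      rw [prod_evalList, apply_ite E, map_sub, map_zero]
      rfl
    by_cases hc : p.1 = c
    · refine ⟨K₁ + K₂ + K, fun N => ?_⟩
      rw [h0, if_pos hc, add_mul, add_mul]
      exact (norm_add_le _ _).trans
        (add_le_add ((norm_sub_le _ _).trans (add_le_add (hK₁ N) (hK₂ N))) (hK N))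
    · refine ⟨K, fun N => ?_⟩
      rw [h0, if_neg hc, zero_add]
      exact hK N

/-- Covariances of order N, divided by N², cost an error O(1/N) when each expectation of a product
of traces is replaced by the product of mean traces. -/
theorem exists_norm_splitSum_sub_le (h : HasMomentExpansion E Z col) (c : κ)
    (hl : ∀ p ∈ l, IsPolynomial Z Set.univ p.2) (hQ : IsPolynomial Z Set.univ Q) :
    ∃ K : ℝ, ∀ N : ℕ, ‖E (splitSum c (Q N) (evalList N l)) / ((N : ℂ) + 1) ^ 2
      - splitLim E c Q l N‖ ≤ K / (N + 1) := by
  induction l generalizing Q with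
  | nil => exact ⟨0, fun N => by simp [evalList, splitSum, splitLim]⟩
  | cons p l ih =>
    have hp := hl p List.mem_cons_self
    have hl' : ∀ q ∈ l, IsPolynomial Z Set.univ q.2 := fun q hq => hl q (List.mem_cons_of_mem _ hq)
    obtain ⟨K, hK⟩ := ih hl' (hQ.mul hp)
    have hprod := isPolynomial_prod hl'
    obtain ⟨K₁, hK₁⟩ := hQ.exists_norm_sub_le h (hp.mul hprod)
    obtain ⟨K₂, hK₂⟩ := (hQ.mul hp).exists_norm_sub_le h hprod
    have h0 : ∀ N, E (splitSum c (Q N) (evalList N (p :: l))) = (if p.1 = c then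
        E ((Q N).trace * ((p.2 * (l.map Prod.snd).prod) N).trace)
          - E (((Q * p.2) N).trace * ((l.map Prod.snd).prod N).trace) else 0)
        + E (splitSum c ((Q * p.2) N) (evalList N l)) := by
      intro N
      rw [evalList, List.map_cons, splitSum, map_add]
      change E (if p.1 = c then (Q N).trace * (p.2 N * ((evalList N l).map Prod.snd).prod).trace
        - (Q N * p.2 N).trace * ((evalList N l).map Prod.snd).prod.trace else 0) + _ = _
      rw [prod_evalList, apply_ite E, map_sub, map_zero]
      rfl
    by_cases hc : p.1 = c
    · refine ⟨K₁ + K₂ + K, fun N => ?_⟩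
      rw [h0, splitLim, Pi.add_apply, if_pos hc, if_pos hc, add_div, sub_div, add_sub_add_comm,
        add_div, add_div]
      refine (norm_add_le _ _).trans (add_le_add ?_ (hK N))
      rw [Pi.sub_apply, Pi.mul_apply, Pi.mul_apply, sub_sub_sub_comm]
      exact (norm_sub_le _ _).trans (add_le_add (hK₁ N) (hK₂ N))
    · refine ⟨K, fun N => ?_⟩
      rw [h0, splitLim, Pi.add_apply, if_neg hc, if_neg hc, zero_add, Pi.zero_apply, zero_add]
      exact hK N

theorem tendsto_zero_of_norm_le_div {u : ℕ → ℂ} {K : ℝ} (h : ∀ N : ℕ, ‖u N‖ ≤ K / (N + 1)) :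
    Tendsto u atTop (𝓝 0) := by
  refine squeeze_zero_norm h ?_
  have := (tendsto_one_div_add_atTop_nhds_zero_nat (𝕜 := ℝ)).const_mul K
  simpa only [mul_one_div, mul_zero] using this

theorem tendsto_splitLim (h : HasMomentExpansion E Z col) (c : κ)
    (hl : ∀ p ∈ l, IsPolynomial Z {x | col x = p.1} p.2) :
    Tendsto (splitLim E c 1 l) atTop (𝓝 0) := by
  have hl' : ∀ p ∈ l, IsPolynomial Z Set.univ p.2 := fun p hp => (hl p hp).mono (Set.subset_univ _)
  obtain ⟨K, hK⟩ := exists_norm_splitSum_sub_le h c hl' IsPolynomial.one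
  obtain ⟨K', hK'⟩ := exists_norm_twistSum_le h c hl' IsPolynomial.one
  refine tendsto_zero_of_norm_le_div (K := K' + K) fun N => ?_
  have h1 : E (splitSum c 1 (evalList N l)) = E (twistSum c 1 (evalList N l)) := by
    refine expectation_splitSum_eq (col := col) (Z := Z N)
      (fun n L c => h.rotationInvariant L c N) c _ fun p hp => ?_
    obtain ⟨q, hq, rfl⟩ := List.mem_map.1 hp
    exact (hl q hq).apply_mem_colourSpan N
  have hp : (0 : ℝ) < (N : ℝ) + 1 := by positivity
  have h2 : ‖E (splitSum c 1 (evalList N l)) / ((N : ℂ) + 1) ^ 2‖ ≤ K' / (N + 1) := by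
    rw [h1, norm_div, norm_pow, norm_natCast_add_one, div_le_div_iff₀ (by positivity) hp]
    calc _ ≤ K' * (N + 1) * (N + 1) := mul_le_mul_of_nonneg_right (hK' N) hp.le
      _ = _ := by ring
  have h3 := hK N
  rw [norm_sub_rev] at h3
  calc ‖splitLim E c 1 l N‖
      = ‖E (splitSum c 1 (evalList N l)) / ((N : ℂ) + 1) ^ 2 + (splitLim E c 1 l N
          - E (splitSum c 1 (evalList N l)) / ((N : ℂ) + 1) ^ 2)‖ := by congr 1; ring
    _ ≤ K' / (N + 1) + K / (N + 1) := (norm_add_le _ _).trans (add_le_add h2 h3)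
    _ = _ := by ring

theorem tendsto_mul_of_bounded {u v : ℕ → ℂ} {K : ℝ} (hu : ∀ N, ‖u N‖ ≤ K)
    (hv : Tendsto v atTop (𝓝 0)) : Tendsto (u * v) atTop (𝓝 0) :=
  isBoundedUnder_le_mul_tendsto_zero (isBoundedUnder_of ⟨K, hu⟩) hv

/-- Up to terms that involve shorter alternating products, the loop equation for the colour of the
last factor is the mean trace of the whole product. -/
theorem tendsto_splitLim_add_meanTrace (h : HasMomentExpansion E Z col)
    {b : κ × ((N : ℕ) → Matrix (Fin (N + 1)) (Fin (N + 1)) 𝓡)} (hl : IsAlternatingCentred E Z col l)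
    (ih : ∀ l', IsAlternatingCentred E Z col l' → l' ≠ [] → l'.length < l.length →
      Tendsto (meanTrace E (l'.map Prod.snd).prod) atTop (𝓝 0))
    (mid l₁ : List (κ × ((N : ℕ) → Matrix (Fin (N + 1)) (Fin (N + 1)) 𝓡))) (hl₁ : l₁ ≠ [])
    (heq : l = l₁ ++ (mid ++ [b])) :
    Tendsto (splitLim E b.1 (l₁.map Prod.snd).prod (mid ++ [b])
      + meanTrace E (l.map Prod.snd).prod) atTop (𝓝 0) := by
  induction mid generalizing l₁ with
  | nil =>
    -- At the last factor, τ(Q) τ(b) vanishes because `b` is centred, and -τ(Qb) τ(1) is minus the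
    -- mean trace of the whole product.
    have hb := (hl.2 b (by simp [heq])).2
    have : splitLim E b.1 (l₁.map Prod.snd).prod ([] ++ [b])
        + meanTrace E (l.map Prod.snd).prod = 0 := by
      funext N
      simp [splitLim, heq, hb, meanTrace_one h.map_one]
    rw [this]
    exact tendsto_const_nhds
  | cons p mid ihm =>
    have hP : IsAlternatingCentred E Z col l₁ := hl.infix ⟨[], p :: mid ++ [b], by simp [heq]⟩
    obtain ⟨K, hK⟩ := hP.isPolynomial_prod.exists_norm_meanTrace_le h
    have hP' : IsAlternatingCentred E Z col (l₁ ++ [p]) := hl.infix ⟨[], mid ++ [b], by simp [heq]⟩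
    obtain ⟨K', hK'⟩ := hP'.isPolynomial_prod.exists_norm_meanTrace_le h
    have hR : IsAlternatingCentred E Z col (mid ++ [b]) :=
      hl.infix ⟨l₁ ++ [p], [], by simp [heq]⟩
    have hR' : IsAlternatingCentred E Z col (p :: (mid ++ [b])) :=
      hl.infix ⟨l₁, [], by simp [heq]⟩
    -- As `l₁` is not empty, both tails are shorter than `l`, so the induction hypothesis applies to
    -- them; their cofactors are merely bounded.
    have hpos : 0 < l₁.length := List.length_pos_of_ne_nil hl₁
    have t₁ := ih _ hR' (by simp) (by simp [heq]; omega)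
    have t₂ := ih _ hR (by simp) (by simp [heq]; omega)
    have t₃ := ihm (l₁ ++ [p]) (by simp) (by simp [heq])
    rw [List.map_append, List.prod_append] at hK' t₃
    simp only [List.map_cons, List.map_nil, List.prod_cons, List.prod_nil, mul_one] at hK' t₁ t₃
    rw [List.cons_append, splitLim, add_assoc]
    rw [← add_zero (0 : ℂ)]
    refine Tendsto.add ?_ t₃
    split_ifs
    · rw [← sub_zero (0 : ℂ)]
      exact (tendsto_mul_of_bounded hK t₁).sub (tendsto_mul_of_bounded hK' t₂)
    · exact tendsto_const_nhds

theorem HasMomentExpansion.tendsto_meanTrace (h : HasMomentExpansion E Z col)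
    (hl : IsAlternatingCentred E Z col l) (hne : l ≠ []) :
    Tendsto (meanTrace E (l.map Prod.snd).prod) atTop (𝓝 0) := by
  induction hn : l.length using Nat.strong_induction_on generalizing l with
  | _ n ih =>
  subst hn
  have ih : ∀ l', IsAlternatingCentred E Z col l' → l' ≠ [] → l'.length < l.length →
      Tendsto (meanTrace E (l'.map Prod.snd).prod) atTop (𝓝 0) :=
    fun l' h1 h2 h3 => ih _ h3 h1 h2 rfl
  obtain ⟨a, t, rfl⟩ := List.exists_cons_of_ne_nil hne
  rcases List.eq_nil_or_concat t with rfl | ⟨mid, b, rfl⟩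
  · have := (hl.2 a List.mem_cons_self).2
    simp [this]
    exact tendsto_const_nhds
  have ha := hl.2 a List.mem_cons_self
  have hb := hl.2 b (by simp)
  have hmid : IsAlternatingCentred E Z col mid := hl.infix ⟨[a], [b], by simp⟩
  by_cases hab : a.1 = b.1
  -- Equal end colours: by traciality the product of `a`, `mid` and `b` has the mean trace of that
  -- of `b.2 * a.2` and `mid`. Neighbours differ in colour, so `mid` is not empty.
  · have hmid0 : mid ≠ [] := by
      rintro rfl
      have := hl.1
      simp only [List.concat_eq_append, List.nil_append, List.isChain_cons_cons] at this
      exact this.1 hab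
    have hba : IsPolynomial Z {x | col x = a.1} (b.2 * a.2) := by
      rw [← hab] at hb
      exact hb.1.mul ha.1
    obtain ⟨K, hK⟩ := hba.exists_norm_meanTrace_le h
    set β := meanTrace E (b.2 * a.2) with hβ
    -- The merged factor is recentred. Its mean β depends on N but is bounded, and it multiplies the
    -- alternating product along `mid`.
    set D : (N : ℕ) → Matrix (Fin (N + 1)) (Fin (N + 1)) 𝓡 :=
      fun N => (b.2 * a.2) N - β N • 1 with hD
    have hDl : IsAlternatingCentred E Z col ((a.1, D) :: mid) := by
      constructor
      · have h1 := (hl.infix (l' := a :: mid) ⟨[], [b], by simp⟩).1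
        rw [List.isChain_cons] at h1 ⊢
        exact h1
      · intro p hp
        rcases List.mem_cons.1 hp with rfl | hp
        · exact ⟨hba.sub_smul_one hK, meanTrace_sub_smul_one h.map_one _⟩
        · exact hmid.2 p hp
    have t₁ := ih _ hDl (by simp) (by simp)
    have t₂ := ih _ hmid hmid0 (by simp)
    have key : meanTrace E ((a :: mid.concat b).map Prod.snd).prod
        = meanTrace E (((a.1, D) :: mid).map Prod.snd).prod
          + β * meanTrace E (mid.map Prod.snd).prod := by
      funext N
      simp only [List.concat_eq_append, List.map_cons, List.map_append, List.map_nil,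
        List.prod_cons, List.prod_append, List.prod_nil, mul_one, Pi.add_apply, Pi.mul_apply,
        meanTrace, hD]
      rw [← mul_assoc, Matrix.trace_mul_comm, sub_mul, Matrix.trace_sub, map_sub, smul_mul_assoc,
        one_mul, Matrix.trace_smul, map_smul, smul_eq_mul, ← mul_assoc]
      ring
    rw [key, ← add_zero (0 : ℂ)]
    exact t₁.add (tendsto_mul_of_bounded hK t₂)
  -- Different end colours: the first factor contributes no term, so the equation can start at the
  -- second factor with Q = `a.2`. This excludes the term τ(1) τ(whole), which would cancel the one
  -- from the last factor.
  · have h1 := tendsto_splitLim h b.1 (fun p hp => (hl.2 p hp).1)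
    have h2 := tendsto_splitLim_add_meanTrace (b := b) h hl ih mid [a] (by simp) (by simp)
    rw [splitLim, if_neg hab, zero_add, one_mul, List.concat_eq_append] at h1
    simp only [List.map_cons, List.map_nil, List.prod_cons, List.prod_nil, mul_one] at h2
    have h3 := h2.sub h1
    simp only [List.concat_eq_append, List.map_cons, List.prod_cons] at h3 ⊢
    simpa using h3

end Freeness

/-! ### The algebra of random variables with moments of all orders -/

section MomentAlgebra

variable {Ω κ : Type*} [MeasurableSpace Ω]

/-- The complex random variables with moments of all orders. -/
def momentAlgebra (P : Measure Ω) [IsProbabilityMeasure P] : Subalgebra ℂ (Ω → ℂ) where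
  carrier := {g | ∀ q : ℕ, MemLp g q P}
  mul_mem' {g g'} hg hg' q := by
    -- Hölder's inequality: moments of order 2q of both factors control the moment of order q of the
    -- product.
    have : ENNReal.HolderTriple ((2 * q : ℕ) : ENNReal) ((2 * q : ℕ) : ENNReal) q := by
      refine ⟨?_⟩
      rw [← two_mul, Nat.cast_mul, Nat.cast_ofNat, ENNReal.mul_inv (by simp) (by simp),
        ← mul_assoc, ENNReal.mul_inv_cancel (by simp) (by simp), one_mul]
    exact (hg' (2 * q)).mul (hg (2 * q))
  add_mem' {g g'} hg hg' q := (hg q).add (hg' q)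
  algebraMap_mem' r q := memLp_const r

variable (P : Measure Ω) [IsProbabilityMeasure P]

/-- The expectation of random variables with moments of all orders. -/
noncomputable def expectation : momentAlgebra P →ₗ[ℂ] ℂ where
  toFun g := ∫ ω, g.1 ω ∂P
  map_add' g g' := integral_add (memLp_one_iff_integrable.1 (by exact_mod_cast g.2 1))
    (memLp_one_iff_integrable.1 (by exact_mod_cast g'.2 1))
  map_smul' r g := integral_const_mul r _

/-- Evaluation of random variables at an outcome. -/
def evalAt (ω : Ω) : momentAlgebra P →ₐ[ℂ] ℂ :=
  (Pi.evalAlgHom ℂ (fun _ : Ω => ℂ) ω).comp (momentAlgebra P).val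

theorem expectation_apply (g : momentAlgebra P) : expectation P g = ∫ ω, evalAt P ω g ∂P := rfl

variable {Λ : κ → Type*} {X : (c : κ) → (N : ℕ) → Λ c → Ω → Matrix (Fin N) (Fin N) ℂ}
  {PM : κ → Finset ℤ → Finset (Perm ℤ)} {f : (c : κ) → ℕ → (ℤ → Λ c) → Finset ℤ → Perm ℤ → ℂ}

variable {P}

/-- The matrix of a letter, as a matrix over `momentAlgebra P`. -/
def letterElement (hX : ∀ c, HasPremapExpansion P (X c) (PM c) (f c)) (N : ℕ)
    (x : Σ c, Λ c × ℤˣ) : Matrix (Fin (N + 1)) (Fin (N + 1)) (momentAlgebra P) :=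
  Matrix.of fun i j => ⟨fun ω => letterMatrix X N x ω i j, fun q => by
    have h := (hX x.1).isRandomMatrix (N + 1) N.succ_pos x.2.1
    simp only [letterMatrix, signedMatrix_apply]
    split_ifs
    exacts [(h i j).2 q, (h j i).2 q]⟩

theorem entryExpectation_eq_moment (hX : ∀ c, HasPremapExpansion P (X c) (PM c) (f c))
    {ι : Type*} (L : ι → Σ c, Λ c × ℤˣ) (I : Finset ι) :
    (fun N => entryExpectation (expectation P) (letterElement hX N) L I) = moment P X L I := by
  funext N s
  simp only [entryExpectation, expectation_apply, moment, map_prod]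
  rfl

/-- The bridge from probability to algebra: the loop equation and the induction only see matrices
over a commutative algebra with a linear functional. -/
theorem hasMomentExpansion [Fintype κ] [DecidableEq κ]
    (hX : ∀ c, HasPremapExpansion P (X c) (PM c) (f c))
    (hindep : ∀ N, 0 < N → iIndepFun
      (fun (c : κ) (ω : Ω) (l : Λ c) (i j : Fin N) => X c N l ω i j) P) :
    HasMomentExpansion (expectation P) (letterElement hX) Sigma.fst where
  map_one := by
    rw [expectation_apply]
    simp
  mem L := by
    rw [entryExpectation_eq_moment]
    exact moment_mem hX hindep L _
  sub_mem L J := by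
    rw [entryExpectation_eq_moment, entryExpectation_eq_moment, entryExpectation_eq_moment]
    exact moment_sub_mem hX hindep L (Finset.subset_univ J)
  rotationInvariant L c N := by
    have := moment_rotationInvariant hX hindep L Finset.univ c N
    rw [← entryExpectation_eq_moment hX] at this
    exact this
  exists_transpose x := by
    refine ⟨⟨x.1, x.2.1, -x.2.2⟩, rfl, fun N => ?_⟩
    ext i j ω
    change letterMatrix X N ⟨x.1, x.2.1, -x.2.2⟩ ω i j = letterMatrix X N x ω j i
    simp only [letterMatrix, signedMatrix_apply]
    rcases Int.units_eq_one_or x.2.2 with h | h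
    · rw [h, if_neg (by decide), if_pos rfl]
    · rw [h, if_pos (by decide), if_neg (by decide)]

/-- The values of a polynomial in the ensemble of colour `c` and its transposes, as matrices over
`momentAlgebra P`. -/
noncomputable def polynomialElement (hX : ∀ c, HasPremapExpansion P (X c) (PM c) (f c)) (c : κ)
    (a : FreeAlgebra ℂ (Λ c × ℤˣ)) (N : ℕ) :
    Matrix (Fin (N + 1)) (Fin (N + 1)) (momentAlgebra P) :=
  FreeAlgebra.lift ℂ (fun l => letterElement hX N ⟨c, l⟩) a

theorem isPolynomial_polynomialElement (hX : ∀ c, HasPremapExpansion P (X c) (PM c) (f c)) (c : κ)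
    (a : FreeAlgebra ℂ (Λ c × ℤˣ)) :
    IsPolynomial (letterElement hX) {x | x.1 = c} (polynomialElement hX c a) := by
  induction a using FreeAlgebra.induction with
  | grade0 r =>
    convert IsPolynomial.smul (fun _ => r) ‖r‖ (fun _ => le_rfl) _
      (IsPolynomial.one (Z := letterElement hX) (S := {x | x.1 = c})) using 1
    funext N
    rw [polynomialElement, AlgHom.commutes, Algebra.algebraMap_eq_smul_one]
    rfl
  | grade1 l =>
    convert IsPolynomial.letter (Z := letterElement hX) (S := {x | x.1 = c}) (x := ⟨c, l⟩) rfl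
      using 1
    funext N
    rw [polynomialElement, FreeAlgebra.lift_ι_apply]
  | mul a b iha ihb =>
    convert iha.mul ihb using 1
    funext N
    simp only [polynomialElement, map_mul, Pi.mul_apply]
  | add a b iha ihb =>
    convert IsPolynomial.add _ _ iha ihb using 1
    funext N
    simp only [polynomialElement, map_add, Pi.add_apply]

theorem evalAt_polynomialElement (hX : ∀ c, HasPremapExpansion P (X c) (PM c) (f c)) (c : κ)
    (a : FreeAlgebra ℂ (Λ c × ℤˣ)) (N : ℕ) (ω : Ω) :
    (evalAt P ω).mapMatrix (polynomialElement hX c a N)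
      = evalPoly (fun l ω => signedMatrix l.2 (X c (N + 1) l.1 ω)) a ω := by
  unfold polynomialElement evalPoly
  rw [← AlgHom.comp_apply]
  congr 1
  refine FreeAlgebra.hom_ext ?_
  funext l
  simp only [Function.comp_apply, AlgHom.comp_apply, FreeAlgebra.lift_ι_apply]
  rfl

theorem meanTrace_expectation (A : (N : ℕ) → Matrix (Fin (N + 1)) (Fin (N + 1)) (momentAlgebra P))
    (N : ℕ) :
    meanTrace (expectation P) A N = ∫ ω, ntr ((evalAt P ω).mapMatrix (A N)) ∂P := by
  have h : ∀ ω, ((evalAt P ω).mapMatrix (A N)).trace = evalAt P ω (A N).trace := fun ω =>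
    (AddMonoidHom.map_trace (evalAt P ω) (A N)).symm
  simp only [ntr, h]
  rw [integral_const_mul, meanTrace, expectation_apply, div_eq_inv_mul]
  push_cast
  rfl

theorem asymptoticallyFree [Fintype κ] [DecidableEq κ]
    (hX : ∀ c, HasPremapExpansion P (X c) (PM c) (f c))
    (hindep : ∀ N, 0 < N → iIndepFun
      (fun (c : κ) (ω : Ω) (l : Λ c) (i j : Fin N) => X c N l ω i j) P) :
    AsymptoticallyFree P (Λ := fun c => Λ c × ℤˣ)
      (fun c N l ω => signedMatrix l.2 (X c N l.1 ω)) := by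
  intro p hp w hw a
  -- Sizes are shifted to N + 1, so that index sets are nonempty and carry a group structure.
  rw [← tendsto_add_atTop_iff_nat 1]
  have h := hasMomentExpansion hX hindep
  set B : (i : Fin p) → (N : ℕ) → Matrix (Fin (N + 1)) (Fin (N + 1)) (momentAlgebra P) := fun i N =>
    polynomialElement hX (w i) (a i) N
      - meanTrace (expectation P) (polynomialElement hX (w i) (a i)) N • 1 with hB
  have halt : IsAlternatingCentred (expectation P) (letterElement hX) Sigma.fst
      (List.ofFn fun i => (w i, B i)) := by
    constructor
    · rw [List.isChain_iff_getElem]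
      intro i hi
      rw [List.getElem_ofFn, List.getElem_ofFn]
      exact hw _ _ rfl
    · intro q hq
      obtain ⟨i, rfl⟩ := List.mem_ofFn.1 hq
      have hpoly := isPolynomial_polynomialElement hX (w i) (a i)
      -- The means vary with N but are bounded, so the centred matrices are again polynomials with
      -- bounded coefficients.
      obtain ⟨K, hK⟩ := hpoly.exists_norm_meanTrace_le h
      exact ⟨hpoly.sub_smul_one hK, meanTrace_sub_smul_one h.map_one _⟩
  have hlim := h.tendsto_meanTrace halt (by
    rw [Ne, List.ofFn_eq_nil_iff]; exact hp.ne')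
  refine hlim.congr fun N => ?_
  rw [meanTrace_expectation]
  congr 1
  funext ω
  congr 1
  rw [← prod_evalList, evalList, List.map_ofFn, List.map_ofFn, map_list_prod, List.map_ofFn]
  congr 2
  funext i
  change (evalAt P ω).mapMatrix (B i N) = _
  rw [hB, map_sub, map_smul, map_one, evalAt_polynomialElement, meanTrace_expectation]
  simp only [evalAt_polynomialElement]
  rfl

end MomentAlgebra

end PremapFreeness

/-- Independent ensembles that satisfy the premap expansion are asymptotically free; the algebra of
each colour is generated by the matrices of its ensemble together with their transposes. -/
theorem lemma5p1 {Ω : Type*} [MeasurableSpace Ω] (P : MeasureTheory.Measure Ω)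
    [MeasureTheory.IsProbabilityMeasure P] (C : ℕ) (Λ : Fin C → Type*)
    (X : (c : Fin C) → (N : ℕ) → Λ c → Ω → Matrix (Fin N) (Fin N) ℂ)
    (PM : Fin C → Finset ℤ → Finset (Equiv.Perm ℤ))
    (f : (c : Fin C) → ℕ → (ℤ → Λ c) → Finset ℤ → Equiv.Perm ℤ → ℂ)
    (hX : ∀ c, PremapFreeness.HasPremapExpansion P (X c) (PM c) (f c))
    (hindep : ∀ N, 0 < N → ProbabilityTheory.iIndepFun
      (fun (c : Fin C) (ω : Ω) (l : Λ c) (i j : Fin N) => X c N l ω i j) P) :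
    PremapFreeness.AsymptoticallyFree P (Λ := fun c => Λ c × ℤˣ)
      (fun c N l ω => PremapFreeness.signedMatrix l.2 (X c N l.1 ω)) :=
  PremapFreeness.asymptoticallyFree hX hindep
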